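/- Let $p$ be a prime, let $I$ be a linearly ordered index set, and let $(n_i)_{i\in I}$ be positive integers with $n_i<n_j$ whenever $i<j$ (so $I$ is empty, finite, or of order type $\omega$). For each $i\in I$ let $G_i$ be a homocyclic group of exponent $p^{n_i}$ and finite rank $r_i\ge 1$, i.e. $G_i\cong(\mathbb Z/p^{n_i})^{r_i}$, and let $G=\bigoplus_{i\in I}G_i$. Write an endomorphism $A$ of $G$ as a matrix $(A_{ij})$ with $A_{ij}\in\mathrm{Hom}(G_i,G_j)$. Let $$\sigma:\mathrm{Aut}(G)\to\prod_{i}\mathrm{Aut}(G_i/pG_i)\cong\prod_i GL_{r_i}(\mathbb Z_p),\qquad \lambda_i:\mathrm{Aut}(G_i)\to\mathrm{Aut}(G_i/pG_i)\cong GL_{r_i}(\mathbb Z_p)$$ be the natural epimorphisms, where $\mathbb Z_p=\mathbb Z/p$, $\sigma$ sends $A$ to the family of automorphisms of the $G_i/pG_i$ induced by the $A_{ii}$, and $\lambda_i$ is induced by reduction modulo $p$. A short exact sequence of groups splits if its epimorphism has a right inverse that is a group homomorphism. Consider the exact sequences $$1\to\ker\sigma\to\mathrm{Aut}(G)\xrightarrow{\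 \sigma\ }\prod_i GL_{r_i}(\mathbb Z_p)\to1,\tag{1}$$ $$1\to\ker\lambda_i\to\mathrm{Aut}(G_i)\xrightarrow{\ \lambda_i\ }GL_{r_i}(\mathbb Z_p)\to1.\tag{2i}$$ (2.1.1) If $p\ge5$, then (1) splits if and only if (2i) splits for every $i\in I$. (2.1.2) For any prime $p$, if $n_j-n_i>1$ whenever $j$ is the immediate successor of $i$ in $I$, then (1) splits if and only if (2i) splits for every $i\in I$. Moreover (Corollary 2.8), if $p\ge5$, or if $n_j-n_i>1$ whenever $j$ is the immediate successor of $i$, then $\mathrm{Aut}(G)$ is a semidirect product of $\ker\sigma$ by $\prod_iGL_{r_i}(\mathbb Z_p)$ if and only if, for every $i\in I$, $\mathrm{Aut}(G_i)$ is a semidirect product of its maximal normal $p$-subgroup $O_p(\mathrm{Aut}(G_i))$ by $GL_{r_i}(\mathbb Z_p)$. Here a group $A$ is a semidirect product of a subgroup $N$ by a group $Q$ if $N$ is normal in $A$ and has a complement in $A$ isomorphic to $Q$. -/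

import Mathlib

open scoped DirectSum

namespace SplitAut

universe u v

/-- The automorphism group `𝒜(H)` of an abelian group `H`, as the group of units of its
endomorphism ring. -/
abbrev Aut (H : Type v) [AddCommGroup H] : Type v := (AddMonoid.End H)ˣ

/-- The subgroup `pH`. -/
abbrev pMul (p : ℕ) (H : Type v) [AddCommGroup H] : AddSubgroup H :=
  (nsmulAddMonoidHom p : H →+ H).range

/-- The quotient `H / pH`. -/
abbrev ModP (p : ℕ) (H : Type v) [AddCommGroup H] : Type v := H ⧸ pMul p H

/-- `H` is homocyclic of exponent `p ^ n` (with `n ≥ 1`) and finite rank `r ≥ 1`: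
a direct sum of `r` cyclic groups of order `p ^ n`. -/
def IsHomocyclic (p n r : ℕ) (H : Type v) [AddCommGroup H] : Prop :=
  0 < n ∧ 0 < r ∧ Nonempty (H ≃+ (Fin r → ZMod (p ^ n)))

theorem mem_pMul {p : ℕ} {H : Type v} [AddCommGroup H] {x : H} :
    x ∈ pMul p H ↔ ∃ y : H, p • y = x := Iff.rfl

theorem map_mem_pMul {p : ℕ} {H K : Type v} [AddCommGroup H] [AddCommGroup K] (f : H →+ K)
    {x : H} (hx : x ∈ pMul p H) : f x ∈ pMul p K := by
  obtain ⟨y, rfl⟩ := mem_pMul.1 hx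
  exact mem_pMul.2 ⟨f y, (map_nsmul f p y).symm⟩

/-- Reduction of endomorphisms `End H → End (H / pH)`. -/
def endModP (p : ℕ) (H : Type v) [AddCommGroup H] :
    AddMonoid.End H →* AddMonoid.End (ModP p H) where
  toFun f := QuotientAddGroup.map (pMul p H) (pMul p H) f (fun _ hx => map_mem_pMul f hx)
  map_one' := AddMonoidHom.ext fun x => QuotientAddGroup.induction_on x fun _ => rfl
  map_mul' _ _ := AddMonoidHom.ext fun x => QuotientAddGroup.induction_on x fun _ => rfl

/-- The natural map `λ : 𝒜(H) → 𝒜(H / pH)`. -/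
def lam (p : ℕ) (H : Type v) [AddCommGroup H] : Aut H →* Aut (ModP p H) :=
  Units.map (endModP p H)

/-- A surjective homomorphism `f` gives the short exact sequence `1 → ker f → E → Q → 1`. -/
def kerExtension {E : Type*} {Q : Type*} [Group E] [Group Q] (f : E →* Q)
    (hf : Function.Surjective f) : GroupExtension f.ker E Q where
  inl := f.ker.subtype
  rightHom := f
  inl_injective := f.ker.subtype_injective
  range_inl_eq_ker_rightHom := f.ker.range_subtype
  rightHom_surjective := hf

theorem IsHomocyclic.nsmul_eq_zero {p n r : ℕ} {H : Type v} [AddCommGroup H]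
    (h : IsHomocyclic p n r H) (x : H) : p ^ n • x = 0 := by
  obtain ⟨-, -, ⟨e⟩⟩ := h
  apply e.injective
  rw [map_nsmul, map_zero]
  ext k
  rw [Pi.smul_apply, nsmul_eq_mul, ZMod.natCast_self, zero_mul, Pi.zero_apply]

theorem IsHomocyclic.mem_pMul_of_nsmul_eq_zero {p n r : ℕ} (hp : p.Prime) {H : Type v}
    [AddCommGroup H] (h : IsHomocyclic p n r H) {k : ℕ} (hk : k < n) {x : H}
    (hx : p ^ k • x = 0) : x ∈ pMul p H := by
  obtain ⟨-, -, ⟨e⟩⟩ := h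
  have : NeZero (p ^ n) := ⟨pow_ne_zero _ hp.ne_zero⟩
  have key : ∀ a : ZMod (p ^ n), p ^ k • a = 0 → ∃ b : ZMod (p ^ n), p • b = a := by
    intro a ha
    have h1 : ((p ^ k * a.val : ℕ) : ZMod (p ^ n)) = 0 := by
      rw [Nat.cast_mul, ZMod.natCast_zmod_val, ← nsmul_eq_mul]; exact ha
    rw [ZMod.natCast_eq_zero_iff] at h1
    have h2 : p ^ k * p ∣ p ^ k * a.val :=
      dvd_trans (by rw [← pow_succ]; exact pow_dvd_pow _ hk) h1
    obtain ⟨c, hc⟩ := Nat.dvd_of_mul_dvd_mul_left (pow_pos hp.pos k) h2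
    refine ⟨(c : ZMod (p ^ n)), ?_⟩
    rw [nsmul_eq_mul, ← Nat.cast_mul, ← hc, ZMod.natCast_zmod_val]
  have h3 : ∀ t, ∃ b : ZMod (p ^ n), p • b = e x t := by
    intro t
    apply key
    have := congrArg (fun y => e y t) hx
    simpa [map_nsmul] using this
  choose b hb using h3
  refine mem_pMul.2 ⟨e.symm b, e.injective ?_⟩
  rw [map_nsmul, AddEquiv.apply_symm_apply]
  ext t
  exact hb t

theorem lam_surjective {p n r : ℕ} (hp : p.Prime) {H : Type v} [AddCommGroup H]
    (h : IsHomocyclic p n r H) : Function.Surjective (lam p H) := by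
  have : NeZero (p ^ n) := ⟨pow_ne_zero _ hp.ne_zero⟩
  have htors := h.nsmul_eq_zero
  obtain ⟨-, -, ⟨e⟩⟩ := id h
  have hfin : Finite H := Finite.of_equiv _ e.toEquiv.symm
  intro u
  let q : H →+ ModP p H := QuotientAddGroup.mk' (pMul p H)
  have hq : Function.Surjective q := QuotientAddGroup.mk'_surjective _
  have htorsQ : ∀ x : ModP p H, p ^ n • x = 0 := fun x => by
    obtain ⟨y, rfl⟩ := hq x
    rw [← map_nsmul, htors, map_zero]
  obtain ⟨f, hf'⟩ : ∃ f : H →+ H, ∀ x, q (f x) = u.1 (q x) := by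
    let _ : Module (ZMod (p ^ n)) H := AddCommGroup.zmodModule htors
    let _ : Module (ZMod (p ^ n)) (ModP p H) := AddCommGroup.zmodModule htorsQ
    let eL : (Fin r → ZMod (p ^ n)) ≃ₗ[ZMod (p ^ n)] H :=
      LinearEquiv.ofBijective (e.symm.toAddMonoidHom.toZModLinearMap (p ^ n)) e.symm.bijective
    have hproj : Module.Projective (ZMod (p ^ n)) H :=
      Module.Projective.of_equiv' (R := ZMod (p ^ n)) (M := Fin r → ZMod (p ^ n)) eL
    let qL : H →ₗ[ZMod (p ^ n)] ModP p H := q.toZModLinearMap (p ^ n)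
    let uL : H →ₗ[ZMod (p ^ n)] ModP p H :=
      (AddMonoidHom.comp (u.1 : ModP p H →+ ModP p H) q).toZModLinearMap (p ^ n)
    obtain ⟨f, hf⟩ := Module.projective_lifting_property (h := hproj) qL uL hq
    exact ⟨f.toAddMonoidHom, fun x => LinearMap.congr_fun hf x⟩
  have hstep : ∀ k : ℕ, ∀ x : H, ∃ y z : H, x = f y + p ^ k • z := by
    intro k
    induction k with
    | zero => intro x; exact ⟨0, x, by simp⟩
    | succ k ih =>
      intro x
      obtain ⟨y, z, rfl⟩ := ih x
      obtain ⟨w, hw⟩ := hq (u.2 (q z))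
      have h1 : q (f w) = q z := by
        rw [hf', hw]
        exact DFunLike.congr_fun u.3 (q z)
      obtain ⟨t, ht⟩ := mem_pMul.1 (QuotientAddGroup.eq.1 h1)
      refine ⟨y + p ^ k • w, t, ?_⟩
      have hz : z = f w + p • t := by rw [ht]; abel
      rw [map_add, map_nsmul, hz, nsmul_add, pow_succ, mul_nsmul', add_assoc]
  have hsurj : Function.Surjective f := by
    intro x
    obtain ⟨y, z, hx⟩ := hstep n x
    exact ⟨y, by rw [hx, htors, add_zero]⟩
  have hbij : Function.Bijective f := ⟨Finite.injective_iff_surjective.2 hsurj, hsurj⟩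
  let E : H ≃+ H := AddEquiv.ofBijective f hbij
  refine ⟨⟨E.toAddMonoidHom, E.symm.toAddMonoidHom, ?_, ?_⟩, ?_⟩
  · ext x; exact E.apply_symm_apply x
  · ext x; exact E.symm_apply_apply x
  · apply Units.ext
    ext x
    exact QuotientAddGroup.induction_on x hf'

/-- `𝒜(H / pH)` is isomorphic to `GL_r(ℤ/p)` for `H` homocyclic of rank `r`. -/
theorem nonempty_aut_modP_mulEquiv {p n r : ℕ} (hp : p.Prime) {H : Type v} [AddCommGroup H]
    (h : IsHomocyclic p n r H) :
    Nonempty (Aut (ModP p H) ≃* Matrix.GeneralLinearGroup (Fin r) (ZMod p)) := by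
  obtain ⟨hn, -, ⟨e⟩⟩ := id h
  have hd : p ∣ p ^ n := dvd_pow_self p hn.ne'
  let c : ZMod (p ^ n) →+* ZMod p := ZMod.castHom hd (ZMod p)
  have hc : Function.Surjective c := ZMod.castHom_surjective hd
  let φ : H →+ (Fin r → ZMod p) :=
    (AddMonoidHom.compLeft c.toAddMonoidHom (Fin r)).comp e.toAddMonoidHom
  have hφ : Function.Surjective φ := (hc.comp_left).comp e.surjective
  have hker : pMul p H = φ.ker := by
    ext x
    constructor
    · rintro ⟨y, rfl⟩
      ext t
      change φ (p • y) t = 0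
      rw [map_nsmul, Pi.smul_apply, nsmul_eq_mul, ZMod.natCast_self, zero_mul]
    · intro hx
      refine h.mem_pMul_of_nsmul_eq_zero hp (Nat.sub_lt hn one_pos) (e.injective ?_)
      rw [map_nsmul, map_zero]
      ext t
      have h0 : c (e x t) = 0 := congrFun hx t
      have : NeZero (p ^ n) := ⟨pow_ne_zero _ hp.ne_zero⟩
      rw [← ZMod.natCast_zmod_val (e x t), map_natCast, ZMod.natCast_eq_zero_iff] at h0
      rw [Pi.smul_apply, nsmul_eq_mul, ← ZMod.natCast_zmod_val (e x t), ← Nat.cast_mul,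
        Pi.zero_apply, ZMod.natCast_eq_zero_iff]
      calc p ^ n = p ^ (n - 1) * p := by rw [← pow_succ, Nat.sub_add_cancel hn]
        _ ∣ _ := mul_dvd_mul_left _ h0
  let E : ModP p H ≃+ (Fin r → ZMod p) :=
    (QuotientAddGroup.quotientAddEquivOfEq hker).trans
      (QuotientAddGroup.quotientKerEquivOfSurjective φ hφ)
  let F : AddMonoid.End (ModP p H) ≃* Module.End (ZMod p) (Fin r → ZMod p) :=
    { toFun := fun f => (E.toAddMonoidHom.comp
        (AddMonoidHom.comp f E.symm.toAddMonoidHom)).toZModLinearMap p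
      invFun := fun g => E.symm.toAddMonoidHom.comp (g.toAddMonoidHom.comp E.toAddMonoidHom)
      left_inv := fun f => AddMonoidHom.ext fun x =>
        (E.symm_apply_apply _).trans (congrArg f (E.symm_apply_apply x))
      right_inv := fun g => LinearMap.ext fun x =>
        (E.apply_symm_apply _).trans (congrArg g (E.apply_symm_apply x))
      map_mul' := fun f g => LinearMap.ext fun x =>
        congrArg (fun y => E (f y)) (E.symm_apply_apply _).symm }
  exact ⟨Units.mapEquiv (F.trans (LinearMap.toMatrixAlgEquiv' (R := ZMod p)).toMulEquiv)⟩

/-- The exact sequence `1 → ker λ → 𝒜(H) → 𝒜(H / pH) → 1` of a homocyclic group `H` of exponent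
`p ^ n` and rank `r`; here `𝒜(H / pH)` is a copy of `GL_r(ℤ/p)`. -/
def homocyclicExtension {p n r : ℕ} (hp : p.Prime) {H : Type v} [AddCommGroup H]
    (h : IsHomocyclic p n r H) : GroupExtension (lam p H).ker (Aut H) (Aut (ModP p H)) :=
  kerExtension (lam p H) (lam_surjective hp h)

section Sum

variable {ι : Type u} [LinearOrder ι] {G : ι → Type v} [∀ i, AddCommGroup (G i)]

/-- The matrix entry `A_{ij} : G_i → G_j` of an endomorphism `A` of `⨁ G_i`. -/
def block (A : AddMonoid.End (⨁ i, G i)) (i j : ι) : G i →+ G j :=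
  (DFinsupp.evalAddMonoidHom j).comp ((A : (⨁ i, G i) →+ ⨁ i, G i).comp (DirectSum.of G i))

theorem block_apply (A : AddMonoid.End (⨁ i, G i)) (i j : ι) (x : G i) :
    block A i j x = A (DirectSum.of G i x) j := rfl

theorem block_mul_sub_mem {p : ℕ} {n r : ι → ℕ} (hp : p.Prime)
    (hG : ∀ i, IsHomocyclic p (n i) (r i) (G i)) (hn : StrictMono n)
    (B A : AddMonoid.End (⨁ i, G i)) (i : ι) (g : G i) :
    block (B * A) i i g - block B i i (block A i i g) ∈ pMul p (G i) := by
  classical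
  set x : ⨁ i, G i := A (DirectSum.of G i g) with hx
  have h1 : block (B * A) i i g - block B i i (block A i i g)
      = (∑ j ∈ DFinsupp.support x, B (DirectSum.of G j (x j)) i) -
        B (DirectSum.of G i (x i)) i := by
    have h2 : (∑ j ∈ DFinsupp.support x, B (DirectSum.of G j (x j)) i) = B x i := by
      conv_rhs => rw [← DirectSum.sum_support_of x]
      rw [map_sum, DFinsupp.finsetSum_apply]
    rw [h2]
    rfl
  have hoff : ∀ j, j ≠ i → B (DirectSum.of G j (x j)) i ∈ pMul p (G i) := by
    intro j hj
    rcases lt_or_gt_of_ne hj with hlt | hgt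
    · refine (hG i).mem_pMul_of_nsmul_eq_zero hp (hn hlt) ?_
      rw [← block_apply, ← map_nsmul, (hG j).nsmul_eq_zero, map_zero]
    · rw [← block_apply]
      refine map_mem_pMul _ ((hG j).mem_pMul_of_nsmul_eq_zero hp (hn hgt) ?_)
      rw [hx, ← block_apply, ← map_nsmul, (hG i).nsmul_eq_zero, map_zero]
  rw [h1]
  by_cases hi : i ∈ DFinsupp.support x
  · rw [← Finset.add_sum_erase _ _ hi, add_sub_cancel_left]
    exact sum_mem fun j hj => hoff j (Finset.ne_of_mem_erase hj)
  · have h0 : x i = 0 := by simpa using hi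
    rw [h0, map_zero, map_zero, DirectSum.zero_apply, sub_zero]
    exact sum_mem fun j hj => hoff j (fun h => hi (h ▸ hj))

/-- The map `End (⨁ G_i) → End (G_i / pG_i)`, `A ↦ A_{ii} mod p`. -/
def diagModP {p : ℕ} {n r : ι → ℕ} (hp : p.Prime)
    (hG : ∀ i, IsHomocyclic p (n i) (r i) (G i)) (hn : StrictMono n) (i : ι) :
    AddMonoid.End (⨁ i, G i) →* AddMonoid.End (ModP p (G i)) where
  toFun A := endModP p (G i) (block A i i)
  map_one' := by
    refine Eq.trans ?_ (map_one (endModP p (G i)))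
    exact congrArg (endModP p (G i)) (AddMonoidHom.ext fun x => DirectSum.of_eq_same i x)
  map_mul' B A := by
    refine Eq.trans ?_ ((endModP p (G i)).map_mul (block B i i) (block A i i))
    refine AddMonoidHom.ext fun y => QuotientAddGroup.induction_on y fun x => ?_
    refine (QuotientAddGroup.eq (s := pMul p (G i))).2 ?_
    have h := neg_mem (block_mul_sub_mem hp hG hn B A i x)
    rwa [neg_sub, sub_eq_neg_add] at h

/-- The natural map `σ : 𝒜(⨁ G_i) → ∏ 𝒜(G_i / pG_i)`, `A ↦ (A_{ii} mod p)_i`. -/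
def sigma {p : ℕ} {n r : ι → ℕ} (hp : p.Prime)
    (hG : ∀ i, IsHomocyclic p (n i) (r i) (G i)) (hn : StrictMono n) :
    Aut (⨁ i, G i) →* ∀ i, Aut (ModP p (G i)) :=
  MonoidHom.pi fun i => Units.map (diagModP hp hG hn i)

theorem sigma_surjective {p : ℕ} {n r : ι → ℕ} (hp : p.Prime)
    (hG : ∀ i, IsHomocyclic p (n i) (r i) (G i)) (hn : StrictMono n) :
    Function.Surjective (sigma hp hG hn) := by
  intro u
  choose a ha using fun i => lam_surjective hp (hG i) (u i)
  refine ⟨⟨DirectSum.map fun i => (a i).1, DirectSum.map fun i => (a i).2, ?_, ?_⟩, ?_⟩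
  · refine AddMonoidHom.ext fun x => DFinsupp.ext fun i => ?_
    exact DFunLike.congr_fun (a i).3 (x i)
  · refine AddMonoidHom.ext fun x => DFinsupp.ext fun i => ?_
    exact DFunLike.congr_fun (a i).4 (x i)
  · ext i : 1
    rw [← ha i]
    apply Units.ext
    change endModP p (G i) _ = endModP p (G i) _
    refine congrArg (endModP p (G i)) (AddMonoidHom.ext fun x => ?_)
    exact (congrArg (fun y : ⨁ i, G i => y i)
      (DirectSum.map_of (fun i => ((a i).1 : G i →+ G i)) i x)).trans (DirectSum.of_eq_same i _)

/-- The exact sequence `1 → ker σ → 𝒜(⨁ G_i) → ∏ 𝒜(G_i / pG_i) → 1`; here `𝒜(G_i / pG_i)` is a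
copy of `GL_{r_i}(ℤ/p)`. -/
def sumExtension {p : ℕ} {n r : ι → ℕ} (hp : p.Prime)
    (hG : ∀ i, IsHomocyclic p (n i) (r i) (G i)) (hn : StrictMono n) :
    GroupExtension (sigma hp hG hn).ker (Aut (⨁ i, G i)) (∀ i, Aut (ModP p (G i))) :=
  kerExtension (sigma hp hG hn) (sigma_surjective hp hG hn)

end Sum

/-- The maximal normal `p`-subgroup `O_p(A)` of a group `A`, as the join of all normal
`p`-subgroups. -/
def Op (p : ℕ) (A : Type*) [Group A] : Subgroup A :=
  sSup {N : Subgroup A | N.Normal ∧ IsPGroup p N}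

/-- `A` is a semidirect product of its subgroup `N` by the group `Q`: `N` is normal and has a
complement in `A` that is isomorphic to `Q`. -/
def IsSemidirectProduct {A : Type*} [Group A] (N : Subgroup A) (Q : Type*) [Group Q] : Prop :=
  N.Normal ∧ ∃ K : Subgroup A, N.IsComplement' K ∧ Nonempty (K ≃* Q)

end SplitAut

namespace SplitAut

/-! ### Split extensions and complements of kernels -/

section Extensions

variable {E Q : Type*} [Group E] [Group Q]

/-! Sections of every λ_i assemble block-diagonally into a section of σ. The converse does not
convert a section of σ into one of λ_i; it goes through a list of cases. By `exists_lam_section`,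
λ_i has a section as soon as n_i = 1, or r_i = 1, or p = 2 and r_i ≤ 3, or p = 3 and r_i ≤ 2. It is
then enough that a section of σ forces every i into this list.

The listed sections come from representations in characteristic zero: Teichmüller lifts in rank one,
the reflection representation of S₃ for GL₂(2), a two-dimensional representation over ℤ[1/2, √-2]
for GL₂(3), and Klein's representation of PSL₂(7) over ℤ[(-1+√-7)/2] for GL₃(2), the irrationalities
being p-adic by Hensel lifting.

If p ≥ 5, n_i ≥ 2 and r_i ≥ 2, lift a transvection at i to A = 1 + N with A ^ p = 1. The linear term
p N of the binomial expansion is the only one that can contribute to the i-component on p ^ (n_i -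
2) G_i (`block_mem_of_one_add_pow_eq_one`), so N_ii vanishes modulo p, against the choice of a
nontrivial transvection.

If the exponents have gaps of at least 2, then A ↦ A_ii mod p² is multiplicative, since every detour
through another summand is divisible by p². A section of σ thus gives a lift of GL_r(ℤ/p) to
matrices over ℤ/p². For p = 2, r ≥ 4 and p = 3, r ≥ 3 this is refuted by relations among a few
transvections (`not_exists_section_two`, `not_exists_section_three`).

For the semidirect products, O_p(Aut G_i) = ker λ_i (`Op_aut_eq_ker_lam`), because ker λ_i is a
p-group and GL_r(ℤ/p) has no nontrivial normal p-subgroup. -/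

theorem nonempty_splitting_kerExtension_iff (f : E →* Q) (hf : Function.Surjective f) :
    Nonempty (kerExtension f hf).Splitting ↔ ∃ s : Q →* E, ∀ q, f (s q) = q :=
  ⟨fun ⟨s⟩ => ⟨s.toMonoidHom, s.rightInverse_rightHom⟩, fun ⟨s, hs⟩ => ⟨⟨s, hs⟩⟩⟩

/-- `f` restricts to an isomorphism from any complement of its kernel onto `Q`, and the inverse of
this isomorphism is the section. The range of a section is conversely a complement. -/
theorem isSemidirectProduct_ker_iff (f : E →* Q) (hf : Function.Surjective f) {Q' : Type*}
    [Group Q'] (e : Q ≃* Q') :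
    IsSemidirectProduct f.ker Q' ↔ ∃ s : Q →* E, ∀ q, f (s q) = q := by
  constructor
  · rintro ⟨-, K, hK, -⟩
    have hbij : Function.Bijective (f.comp K.subtype) := by
      constructor
      · rw [injective_iff_map_eq_one]
        intro k hk
        exact Subtype.ext (Subgroup.disjoint_def.1 hK.disjoint (MonoidHom.mem_ker.2 hk) k.2)
      · intro q
        obtain ⟨x, rfl⟩ := hf q
        obtain ⟨⟨a, k⟩, h⟩ := hK.2 x
        have h' : (a : E) * k = x := h
        refine ⟨k, ?_⟩
        rw [← h', map_mul, MonoidHom.mem_ker.1 a.2, one_mul]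
        rfl
    let F := MulEquiv.ofBijective _ hbij
    exact ⟨K.subtype.comp F.symm.toMonoidHom, fun q => F.apply_symm_apply q⟩
  · rintro ⟨s, hs⟩
    have hinj : Function.Injective s := Function.LeftInverse.injective hs
    refine ⟨inferInstance, s.range, Subgroup.isComplement'_of_disjoint_and_mul_eq_univ ?_ ?_,
      ⟨(MonoidHom.ofInjective hinj).symm.trans e⟩⟩
    · rw [Subgroup.disjoint_def]
      rintro _ hx ⟨q, rfl⟩
      rw [MonoidHom.mem_ker, hs] at hx
      rw [hx, map_one]
    · refine Set.eq_univ_of_forall fun x => ?_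
      refine Set.mem_mul.2 ⟨x * (s (f x))⁻¹, ?_, s (f x), ⟨_, rfl⟩, by group⟩
      rw [SetLike.mem_coe, MonoidHom.mem_ker, map_mul, map_inv, hs, mul_inv_cancel]

end Extensions

/-! ### The largest normal p-subgroup of Aut(H) -/

section NormalPSubgroups

/-- The fixed space `W` of `N` is GL-invariant because `N` is normal, and nonzero when V ≠ 0 by
counting fixed points of a p-group modulo p. A nonzero `v` in `W` and a vector `w` outside it would
be linked by a transvection whose value at `v` differs from `w` by a multiple of `v`, so `W` is
everything. -/
theorem eq_bot_of_normal_of_isPGroup {p : ℕ} [Fact p.Prime] {V : Type*} [AddCommGroup V]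
    [Module (ZMod p) V] [Finite V] (N : Subgroup (LinearMap.GeneralLinearGroup (ZMod p) V))
    [N.Normal] (hN : IsPGroup p N) : N = ⊥ := by
  let W : Submodule (ZMod p) V :=
    { carrier := {v | ∀ g ∈ N, (g : V →ₗ[ZMod p] V) v = v}
      add_mem' := fun {a b} ha hb g hg => by rw [map_add, ha g hg, hb g hg]
      zero_mem' := fun g _ => map_zero _
      smul_mem' := fun c v hv g hg => by rw [map_smul, hv g hg] }
  have hW : ∀ (h : LinearMap.GeneralLinearGroup (ZMod p) V) (v : V), v ∈ W →
      (h : V →ₗ[ZMod p] V) v ∈ W := by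
    intro h v hv g hg
    have h1 := hv _ (Subgroup.Normal.conj_mem' ‹_› g hg h)
    have h2 : g * h = h * (h⁻¹ * g * h) := by group
    calc (g : V →ₗ[ZMod p] V) ((h : V →ₗ[ZMod p] V) v)
        = ((g * h : LinearMap.GeneralLinearGroup (ZMod p) V) : V →ₗ[ZMod p] V) v := rfl
      _ = (h : V →ₗ[ZMod p] V)
            (((h⁻¹ * g * h : LinearMap.GeneralLinearGroup (ZMod p) V) : V →ₗ[ZMod p] V) v) := by
          rw [h2]; rfl
      _ = _ := by rw [h1]
  have htop : W = ⊤ := by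
    by_contra hne
    have hnt : Nontrivial V := by
      by_contra h
      rw [not_nontrivial_iff_subsingleton] at h
      exact hne (Subsingleton.elim _ _)
    have hcard : p ∣ Nat.card V := by
      have h1 := Module.natCard_eq_pow_finrank (K := ZMod p) (V := V)
      rw [h1, Nat.card_zmod]
      exact dvd_pow_self _ (Module.finrank_pos).ne'
    have hmod := hN.card_modEq_card_fixedPoints V
    have hfix : p ∣ Nat.card (MulAction.fixedPoints N V) :=
      (Nat.modEq_zero_iff_dvd.1 (hmod.symm.trans (Nat.modEq_zero_iff_dvd.2 hcard)))
    obtain ⟨v, hv, hv0⟩ : ∃ v ∈ W, v ≠ 0 := by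
      by_contra! hall
      have : Nat.card (MulAction.fixedPoints N V) = 1 := by
        rw [Nat.card_eq_one_iff_unique]
        refine ⟨⟨fun a b => Subtype.ext ?_⟩, ⟨⟨0, fun g => smul_zero g⟩⟩⟩
        rw [hall a.1 fun g hg => a.2 ⟨g, hg⟩, hall b.1 fun g hg => b.2 ⟨g, hg⟩]
      rw [this] at hfix
      exact (Fact.out : p.Prime).one_lt.ne' (Nat.dvd_one.1 hfix)
    obtain ⟨φ, hφ⟩ : ∃ φ : Module.Dual (ZMod p) V, φ v = 1 := by
      have := mt (Module.forall_dual_apply_eq_zero_iff (ZMod p) v).1 hv0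
      push Not at this
      obtain ⟨φ, hφ⟩ := this
      exact ⟨(φ v)⁻¹ • φ, by simp [hφ]⟩
    obtain ⟨w, hw⟩ : ∃ w, w ∉ W := by
      by_contra! h
      exact hne (eq_top_iff.2 fun x _ => h x)
    have hφw : φ (w - φ w • v) = 0 := by simp [hφ]
    let T := LinearEquiv.transvection hφw
    have h1 := hW ((LinearMap.GeneralLinearGroup.generalLinearEquiv _ _).symm T) v hv
    have h2 : ((LinearMap.GeneralLinearGroup.generalLinearEquiv (ZMod p) V).symm T :
        V →ₗ[ZMod p] V) v = v + (w - φ w • v) := by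
      change T v = _
      simp [T, LinearMap.transvection.apply, hφ]
    rw [h2] at h1
    have h3 : w = (v + (w - φ w • v)) - v + φ w • v := by abel
    exact hw (h3 ▸ W.add_mem (W.sub_mem h1 hv) (W.smul_mem _ hv))
  rw [Subgroup.eq_bot_iff_forall]
  intro g hg
  refine Units.ext (LinearMap.ext fun v => ?_)
  exact (htop ▸ Submodule.mem_top : v ∈ W) g hg

/-- If f ≡ 1 modulo p, then f ^ p ^ k ≡ 1 modulo p ^ (k + 1) by induction on k, and at k = n this
modulus kills H. The witnesses are chosen element by element, so the inner induction on the exponent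
m keeps `y` fixed and puts the higher-order error in `z`. -/
theorem pow_eq_one_of_lam_eq_one {p n r : ℕ} {H : Type*} [AddCommGroup H]
    (h : IsHomocyclic p n r H) {u : Aut H} (hu : lam p H u = 1) : u ^ p ^ n = 1 := by
  have key : ∀ f : AddMonoid.End H, (∀ x, ∃ y, f x = x + p • y) → ∀ k : ℕ,
      ∀ x, ∃ y, (f ^ p ^ k) x = x + p ^ (k + 1) • y := by
    intro f hf k
    induction k with
    | zero => simpa using hf
    | succ k ih =>
      have step : ∀ m : ℕ, ∀ x, ∃ y z, (f ^ p ^ k) x = x + p ^ (k + 1) • y ∧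
          ((f ^ p ^ k) ^ m) x = x + m • p ^ (k + 1) • y + p ^ (k + 2) • z := by
        intro m x
        obtain ⟨y, hy⟩ := ih x
        refine ⟨y, ?_⟩
        induction m with
        | zero => exact ⟨0, hy, by simp⟩
        | succ m ihm =>
          obtain ⟨z, -, hz⟩ := ihm
          obtain ⟨w, hw⟩ := ih y
          refine ⟨m • p ^ k • w + (f ^ p ^ k) z, hy, ?_⟩
          rw [pow_succ', AddMonoid.End.coe_mul, Function.comp_apply, hz, map_add, map_add, hy, map_nsmul, map_nsmul,
            hw, map_nsmul]
          have e1 : p ^ (k + 2) • m • p ^ k • w = m • p ^ (k + 1) • p ^ (k + 1) • w := by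
            simp only [← mul_nsmul']; congr 1; ring
          rw [nsmul_add (m • p ^ k • w), e1]
          simp only [nsmul_add, succ_nsmul]
          abel
      intro x
      obtain ⟨y, z, -, hz⟩ := step p x
      refine ⟨y + z, ?_⟩
      rw [pow_succ p k, pow_mul, hz, nsmul_add, ← mul_nsmul', ← pow_succ', add_assoc]
  refine Units.ext (AddMonoidHom.ext fun x => ?_)
  have hf : ∀ x, ∃ y, u.1 x = x + p • y := by
    intro x
    have h1 : endModP p H u.1 = 1 := congrArg Units.val hu
    have h2 : (QuotientAddGroup.mk (u.1 x) : ModP p H) = QuotientAddGroup.mk x :=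
      DFunLike.congr_fun h1 (QuotientAddGroup.mk x)
    obtain ⟨y, hy⟩ := mem_pMul.1 (QuotientAddGroup.eq.1 h2.symm)
    exact ⟨y, by rw [hy]; abel⟩
  obtain ⟨y, hy⟩ := key u.1 hf n x
  change (u.1 ^ p ^ n) x = x
  rw [hy, pow_succ', mul_nsmul', h.nsmul_eq_zero, nsmul_zero, add_zero]

theorem isPGroup_ker_lam {p n r : ℕ} {H : Type*} [AddCommGroup H]
    (h : IsHomocyclic p n r H) : IsPGroup p (lam p H).ker :=
  fun u => ⟨n, Subtype.ext (pow_eq_one_of_lam_eq_one h u.2)⟩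

theorem Op_aut_eq_ker_lam {p n r : ℕ} (hp : p.Prime) {H : Type*} [AddCommGroup H]
    (h : IsHomocyclic p n r H) : Op p (Aut H) = (lam p H).ker := by
  have : Fact p.Prime := ⟨hp⟩
  refine le_antisymm (sSup_le ?_) (le_sSup ⟨inferInstance, isPGroup_ker_lam h⟩)
  rintro N ⟨hN, hpN⟩
  obtain ⟨e⟩ := nonempty_aut_modP_mulEquiv hp h
  let F : Aut H →* LinearMap.GeneralLinearGroup (ZMod p) (Fin r → ZMod p) :=
    (e.trans Matrix.GeneralLinearGroup.toLin).toMonoidHom.comp (lam p H)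
  have hF : Function.Surjective F :=
    (e.trans Matrix.GeneralLinearGroup.toLin).surjective.comp (lam_surjective hp h)
  have hnorm : (N.map F).Normal := hN.map F hF
  have hbot := eq_bot_of_normal_of_isPGroup (N.map F) (hpN.map F)
  rw [Subgroup.map_eq_bot_iff] at hbot
  intro g hg
  have h1 : F g = 1 := hbot hg
  exact (e.trans Matrix.GeneralLinearGroup.toLin).injective (h1.trans (map_one _).symm)

end NormalPSubgroups

/-! ### Matrix coordinates compatible with reduction modulo p -/

section Coordinates

/-- The matrix of an endomorphism of a group with coordinates in `ZMod m`. -/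
def endEquivMatrix {m r : ℕ} {H : Type*} [AddCommGroup H] (e : H ≃+ (Fin r → ZMod m)) :
    AddMonoid.End H ≃+* Matrix (Fin r) (Fin r) (ZMod m) :=
  RingEquiv.trans
    { toFun := fun f => (e.toAddMonoidHom.comp
        (AddMonoidHom.comp f e.symm.toAddMonoidHom)).toZModLinearMap m
      invFun := fun g => e.symm.toAddMonoidHom.comp (g.toAddMonoidHom.comp e.toAddMonoidHom)
      left_inv := fun f => AddMonoidHom.ext fun x =>
        (e.symm_apply_apply _).trans (congrArg f (e.symm_apply_apply x))
      right_inv := fun g => LinearMap.ext fun x =>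
        (e.apply_symm_apply _).trans (congrArg g (e.apply_symm_apply x))
      map_mul' := fun f _ => LinearMap.ext fun _ =>
        congrArg (fun y => e (f y)) (e.symm_apply_apply _).symm
      map_add' := fun _ _ => LinearMap.ext fun _ => e.map_add _ _ }
    (LinearMap.toMatrixAlgEquiv' (R := ZMod m) (n := Fin r)).toRingEquiv

theorem endEquivMatrix_mulVec {m r : ℕ} {H : Type*} [AddCommGroup H]
    (e : H ≃+ (Fin r → ZMod m)) (f : AddMonoid.End H) (x : H) :
    (endEquivMatrix e f).mulVec (e x) = e (f x) := by
  have h : ∀ (g : (Fin r → ZMod m) →ₗ[ZMod m] (Fin r → ZMod m)) (v : Fin r → ZMod m),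
      (LinearMap.toMatrixAlgEquiv' g).mulVec v = g v := fun g v => by
    rw [← Matrix.toLinAlgEquiv'_apply, Matrix.toLinAlgEquiv'_toMatrixAlgEquiv']
  refine (h ((e.toAddMonoidHom.comp
    (AddMonoidHom.comp f e.symm.toAddMonoidHom)).toZModLinearMap m) (e x)).trans ?_
  exact congrArg (fun y => e (f y)) (e.symm_apply_apply x)

theorem exists_matrix_coordinates {p n r : ℕ} (hp : p.Prime) (hd : p ∣ p ^ n) {H : Type*}
    [AddCommGroup H] (h : IsHomocyclic p n r H) :
    ∃ (Φ : AddMonoid.End H ≃+* Matrix (Fin r) (Fin r) (ZMod (p ^ n)))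
      (Ψ : AddMonoid.End (ModP p H) ≃+* Matrix (Fin r) (Fin r) (ZMod p)),
      ∀ f, Ψ (endModP p H f) = (ZMod.castHom hd (ZMod p)).mapMatrix (Φ f) := by
  obtain ⟨hn, -, ⟨e⟩⟩ := id h
  have : NeZero (p ^ n) := ⟨pow_ne_zero _ hp.ne_zero⟩
  set c : ZMod (p ^ n) →+* ZMod p := ZMod.castHom hd (ZMod p)
  have hc : Function.Surjective c := ZMod.castHom_surjective hd
  let φ : H →+ (Fin r → ZMod p) :=
    (AddMonoidHom.compLeft c.toAddMonoidHom (Fin r)).comp e.toAddMonoidHom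
  have hφ : Function.Surjective φ := (hc.comp_left).comp e.surjective
  have hker : pMul p H = φ.ker := by
    ext x
    constructor
    · rintro ⟨y, rfl⟩
      ext t
      change φ (p • y) t = 0
      rw [map_nsmul, Pi.smul_apply, nsmul_eq_mul, ZMod.natCast_self, zero_mul]
    · intro hx
      refine h.mem_pMul_of_nsmul_eq_zero hp (Nat.sub_lt hn one_pos) (e.injective ?_)
      rw [map_nsmul, map_zero]
      ext t
      have h0 : c (e x t) = 0 := congrFun hx t
      rw [← ZMod.natCast_zmod_val (e x t), map_natCast, ZMod.natCast_eq_zero_iff] at h0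
      rw [Pi.smul_apply, nsmul_eq_mul, ← ZMod.natCast_zmod_val (e x t), ← Nat.cast_mul,
        Pi.zero_apply, ZMod.natCast_eq_zero_iff]
      calc p ^ n = p ^ (n - 1) * p := by rw [← pow_succ, Nat.sub_add_cancel hn]
        _ ∣ _ := mul_dvd_mul_left _ h0
  let E : ModP p H ≃+ (Fin r → ZMod p) :=
    (QuotientAddGroup.quotientAddEquivOfEq hker).trans
      (QuotientAddGroup.quotientKerEquivOfSurjective φ hφ)
  have hE : ∀ x : H, E (QuotientAddGroup.mk x) = fun i => c (e x i) := fun x => rfl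
  refine ⟨endEquivMatrix e, endEquivMatrix E, fun f => Matrix.ext_of_mulVec_single fun i => ?_⟩
  obtain ⟨x, hx⟩ := hφ (Pi.single i 1)
  have hx' : E (QuotientAddGroup.mk x) = Pi.single i 1 := hx
  rw [← hx', endEquivMatrix_mulVec]
  change E (QuotientAddGroup.mk (f x)) = _
  rw [hE, hE, ← endEquivMatrix_mulVec e]
  ext j
  exact RingHom.map_mulVec c _ _ j

/-- A monoid homomorphism out of a group takes unit values, so a multiplicative lift into all
matrices already gives automorphisms. -/
theorem exists_lam_section_of_matrix {p n r : ℕ} (hp : p.Prime) (hd : p ∣ p ^ n) {H : Type*}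
    [AddCommGroup H] (h : IsHomocyclic p n r H)
    (s : GL (Fin r) (ZMod p) →* Matrix (Fin r) (Fin r) (ZMod (p ^ n)))
    (hs : ∀ g, (ZMod.castHom hd (ZMod p)).mapMatrix (s g) = g) :
    ∃ s : Aut (ModP p H) →* Aut H, ∀ u, lam p H (s u) = u := by
  obtain ⟨Φ, Ψ, hΨ⟩ := exists_matrix_coordinates hp hd h
  refine ⟨(Units.mapEquiv Φ.symm.toMulEquiv).toMonoidHom.comp
    (s.toHomUnits.comp (Units.mapEquiv Ψ.toMulEquiv).toMonoidHom), fun u => Units.ext ?_⟩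
  apply Ψ.injective
  change Ψ (endModP p H (Φ.symm (s (Units.mapEquiv Ψ.toMulEquiv u)))) = Ψ u.1
  rw [hΨ, RingEquiv.apply_symm_apply, hs]
  rfl

end Coordinates

/-! ### Sections from subgroups of bounded order -/

section Sections

/-- Surjectivity supplies the other inequality of orders, so an upper bound on `K` alone makes `ρ`
bijective on it. -/
theorem exists_section_of_card_le {E Q : Type*} [Group E] [Group Q] [Finite Q] (ρ : E →* Q)
    (K : Subgroup E) [Finite K] (hK : K.map ρ = ⊤) (hcard : Nat.card K ≤ Nat.card Q) :
    ∃ s : Q →* E, ∀ q, ρ (s q) = q := by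
  have hsurj : Function.Surjective (ρ.comp K.subtype) := by
    intro q
    obtain ⟨k, hk, rfl⟩ : q ∈ K.map ρ := hK ▸ Subgroup.mem_top q
    exact ⟨⟨k, hk⟩, rfl⟩
  have hc : Nat.card K = Nat.card Q :=
    le_antisymm hcard (Nat.card_le_card_of_surjective _ hsurj)
  have hbij := (Nat.bijective_iff_surjective_and_card (ρ.comp K.subtype)).2 ⟨hsurj, hc⟩
  let F := MulEquiv.ofBijective _ hbij
  exact ⟨K.subtype.comp F.symm.toMonoidHom, fun q => F.apply_symm_apply q⟩

/-- A group generated by `X`, `D` and an involution `t`, where `t` normalizes `D`, `D` normalizes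
`X` and `t u t ∈ X D t X` for `1 ≠ u ∈ X`, is the union of `X D` and `X D t X`. -/
theorem closure_subset_bruhat {E : Type*} [Group E] (X D : Subgroup E) (t : E) (ht : t * t = 1)
    (htD : ∀ d ∈ D, t * d * t ∈ D) (hDX : ∀ d ∈ D, ∀ u ∈ X, d * u * d⁻¹ ∈ X)
    (hX : ∀ u ∈ X, u ≠ 1 → ∃ u' ∈ X, ∃ d ∈ D, ∃ v ∈ X, t * u * t = u' * d * t * v) :
    (Subgroup.closure (X ∪ D ∪ {t}) : Set E) ⊆
      Set.range (fun a : X × D => (a.1 * a.2 : E)) ∪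
        Set.range (fun a : X × D × X => (a.1 * a.2.1 * t * a.2.2 : E)) := by
  set T := Set.range (fun a : X × D => (a.1 * a.2 : E)) ∪
        Set.range (fun a : X × D × X => (a.1 * a.2.1 * t * a.2.2 : E)) with hT
  have mem1 : ∀ u ∈ X, ∀ d ∈ D, u * d ∈ T := fun u hu d hd => Or.inl ⟨(⟨u, hu⟩, ⟨d, hd⟩), rfl⟩
  have mem2 : ∀ u ∈ X, ∀ d ∈ D, ∀ v ∈ X, u * d * t * v ∈ T := fun u hu d hd v hv =>
    Or.inr ⟨(⟨u, hu⟩, ⟨d, hd⟩, ⟨v, hv⟩), rfl⟩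
  have htinv : t⁻¹ = t := inv_eq_of_mul_eq_one_left ht
  -- `T` contains 1, so stability under right multiplication by the generators suffices. The one
  -- case needing `hX` is v t with v ≠ 1, where t v t is rewritten.
  have step : ∀ x ∈ T, ∀ y ∈ (X ∪ D ∪ {t} : Set E), x * y ∈ T := by
    rintro _ (⟨⟨⟨u, hu⟩, ⟨d, hd⟩⟩, rfl⟩ | ⟨⟨⟨u, hu⟩, ⟨d, hd⟩, ⟨v, hv⟩⟩, rfl⟩) y ((hy | hy) | rfl)
    · have h := mem1 _ (X.mul_mem hu (hDX d hd y hy)) d hd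
      convert h using 1; simp only; group
    · have h := mem1 u hu _ (D.mul_mem hd hy)
      convert h using 1; simp only; group
    · have h := mem2 u hu d hd 1 X.one_mem
      convert h using 1; simp only; group
    · have h := mem2 u hu d hd _ (X.mul_mem hv hy)
      convert h using 1; simp only; group
    · have h := mem2 u hu _ (D.mul_mem hd (htD y hy)) _ (hDX _ (D.inv_mem hy) v hv)
      convert h using 1
      simp only [mul_assoc, inv_inv]
      rw [← mul_assoc t t, ht, one_mul, mul_inv_cancel_left]
    · by_cases hv1 : v = 1
      · subst hv1
        have h := mem1 u hu d hd
        convert h using 1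
        simp only [mul_assoc, one_mul]
        rw [ht, mul_one]
      · obtain ⟨u', hu', d', hd', v', hv', h⟩ := hX v hv hv1
        have h2 := mem2 _ (X.mul_mem hu (hDX d hd u' hu')) _ (D.mul_mem hd hd') v' hv'
        convert h2 using 1
        have e : u * d * y * v * y = u * d * (y * v * y) := by group
        simp only
        rw [e, h]; group
  intro x hx
  induction hx using Subgroup.closure_induction_right with
  | one => simpa using mem1 1 X.one_mem 1 D.one_mem
  | mul_right x hx y hy ih => exact step x ih y hy
  | mul_inv_cancel x hx y hy ih =>
    refine step x ih y⁻¹ ?_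
    rcases hy with (hy | hy) | rfl
    · exact Or.inl (Or.inl (X.inv_mem hy))
    · exact Or.inl (Or.inr (D.inv_mem hy))
    · rw [htinv]; exact Or.inr rfl

/-- This is the order of a finite group with a split BN-pair of rank one. In the applications the
bound evaluates to exactly 6, 48 and 168, the orders of GL₂(2), GL₂(3) and GL₃(2). -/
theorem finite_and_card_closure_le {E : Type*} [Group E] (X D : Subgroup E) [Finite X] [Finite D]
    (t : E) (ht : t * t = 1)
    (htD : ∀ d ∈ D, t * d * t ∈ D) (hDX : ∀ d ∈ D, ∀ u ∈ X, d * u * d⁻¹ ∈ X)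
    (hX : ∀ u ∈ X, u ≠ 1 → ∃ u' ∈ X, ∃ d ∈ D, ∃ v ∈ X, t * u * t = u' * d * t * v) :
    Finite (Subgroup.closure (X ∪ D ∪ {t} : Set E)) ∧
      Nat.card (Subgroup.closure (X ∪ D ∪ {t} : Set E)) ≤
        Nat.card X * Nat.card D * (1 + Nat.card X) := by
  have hsub := closure_subset_bruhat X D t ht htD hDX hX
  have hfin := (Set.finite_range (fun a : X × D => (a.1 * a.2 : E))).union
    (Set.finite_range (fun a : X × D × X => (a.1 * a.2.1 * t * a.2.2 : E)))
  refine ⟨hfin.subset hsub, ?_⟩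
  calc Nat.card (Subgroup.closure (X ∪ D ∪ {t} : Set E))
      ≤ Nat.card ↑(Set.range (fun a : X × D => (a.1 * a.2 : E)) ∪
        Set.range (fun a : X × D × X => (a.1 * a.2.1 * t * a.2.2 : E))) :=
        Nat.card_mono hfin hsub
    _ ≤ _ := by
      simp only [Nat.card_coe_set_eq]
      refine (Set.ncard_union_le _ _).trans ?_
      have h1 : (Set.range (fun a : X × D => (a.1 * a.2 : E))).ncard ≤ Nat.card X * Nat.card D := by
        rw [← Nat.card_prod, ← Nat.card_coe_set_eq]
        exact Finite.card_range_le _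
      have h2 : (Set.range (fun a : X × D × X => (a.1 * a.2.1 * t * a.2.2 : E))).ncard
          ≤ Nat.card X * (Nat.card D * Nat.card X) := by
        rw [← Nat.card_prod, ← Nat.card_prod, ← Nat.card_coe_set_eq]
        exact Finite.card_range_le _
      exact (add_le_add h1 h2).trans (le_of_eq (by ring))

/-- A subgroup of `GL_r(F)` containing all transvections and all diagonal matrices is everything. -/
theorem eq_top_of_transvection_mem {r : ℕ} {F : Type*} [Field F]
    (K : Subgroup (GL (Fin r) F))
    (hT : ∀ i j : Fin r, i ≠ j → ∀ c : F, ∃ g ∈ K, (g : Matrix _ _ F) = Matrix.transvection i j c)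
    (hD : ∀ d : Fin r → F, (∀ i, d i ≠ 0) → ∃ g ∈ K, (g : Matrix _ _ F) = Matrix.diagonal d) :
    K = ⊤ := by
  rw [Subgroup.eq_top_iff']
  intro g
  have key : ∀ M : Matrix (Fin r) (Fin r) F, M.det ≠ 0 → ∃ g ∈ K, (g : Matrix _ _ F) = M := by
    intro M hM
    refine Matrix.diagonal_transvection_induction_of_det_ne_zero
      (fun M => ∃ g ∈ K, (g : Matrix _ _ F) = M) M hM ?_ ?_ ?_
    · intro d hd
      refine hD d fun i hi => hd ?_
      rw [Matrix.det_diagonal]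
      exact Finset.prod_eq_zero (Finset.mem_univ i) hi
    · rintro ⟨i, j, hij, c⟩
      exact hT i j hij c
    · rintro A B - - ⟨g, hg, rfl⟩ ⟨h, hh, rfl⟩
      exact ⟨g * h, K.mul_mem hg hh, rfl⟩
  obtain ⟨h, hh, e⟩ := key g (((Matrix.isUnit_iff_isUnit_det _).1 g.isUnit).ne_zero)
  exact (Units.ext e : h = g) ▸ hh

end Sections

/-! ### Lifting GL₃(2) through Klein's representation of PSL₂(7) -/

section SmallSections

theorem exists_lt_of_mem_zpowers {E : Type*} [Group E] {x u : E} {m : ℕ} (hm : 0 < m)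
    (hx : x ^ m = 1) (hu : u ∈ Subgroup.zpowers x) : ∃ k < m, u = x ^ k := by
  obtain ⟨k, rfl⟩ := Subgroup.mem_zpowers_iff.1 hu
  have hm' : (0 : ℤ) < m := by exact_mod_cast hm
  have h0 := Int.emod_nonneg k hm'.ne'
  have h1 := Int.emod_lt_of_pos k hm'
  refine ⟨(k % m).toNat, by omega, ?_⟩
  rw [← zpow_natCast, Int.toNat_of_nonneg h0]
  conv_lhs => rw [← Int.emod_add_mul_ediv k m]
  rw [zpow_add, zpow_mul, zpow_natCast, hx, one_zpow, mul_one]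

theorem finite_and_card_zpowers_le {E : Type*} [Group E] {x : E} {m : ℕ} (hm : 0 < m)
    (hx : x ^ m = 1) : Finite (Subgroup.zpowers x) ∧ Nat.card (Subgroup.zpowers x) ≤ m :=
  ⟨(isOfFinOrder_iff_pow_eq_one.2 ⟨m, hm, hx⟩).finite_zpowers, by
    rw [Nat.card_zpowers]; exact orderOf_le_of_pow_eq_one hm hx⟩

/-- The cardinality bound coming from the standard presentation of `PSL₂(7)`. -/
theorem finite_and_card_le_of_klein_relations {E : Type*} [Group E] {x y t : E} (hx : x ^ 7 = 1)
    (hy : y ^ 3 = 1) (ht : t * t = 1) (hyx : y * x = x ^ 2 * y) (hty : t * y = y ^ 2 * t)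
    (hxt : (x * t) ^ 3 = 1) :
    ∃ K : Subgroup E, Finite K ∧ Nat.card K ≤ 168 ∧ x ∈ K ∧ y ∈ K ∧ t ∈ K := by
  obtain ⟨hXf, hXc⟩ := finite_and_card_zpowers_le (by norm_num) hx
  obtain ⟨hDf, hDc⟩ := finite_and_card_zpowers_le (by norm_num) hy
  set X := Subgroup.zpowers x
  set D := Subgroup.zpowers y
  have hxX : x ∈ X := Subgroup.mem_zpowers x
  have hyD : y ∈ D := Subgroup.mem_zpowers y
  have htinv : t⁻¹ = t := inv_eq_of_mul_eq_one_left ht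
  have hyinv : y⁻¹ = y ^ 2 := inv_eq_of_mul_eq_one_left (by rw [← pow_succ, hy])
  have hyxy : y * x * y⁻¹ = x ^ 2 := by rw [hyx]; group
  have hconjX : ∀ u ∈ X, y * u * y⁻¹ ∈ X := by
    intro u hu
    obtain ⟨k, -, rfl⟩ := exists_lt_of_mem_zpowers (by norm_num) hx hu
    rw [← conj_pow, hyxy]
    exact X.pow_mem (X.pow_mem hxX 2) k
  have hDX : ∀ d ∈ D, ∀ u ∈ X, d * u * d⁻¹ ∈ X := by
    intro d hd
    obtain ⟨k, -, rfl⟩ := exists_lt_of_mem_zpowers (by norm_num) hy hd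
    clear hd
    induction k with
    | zero => simp
    | succ k ih =>
      intro u hu
      have := hconjX _ (ih u hu)
      convert this using 1
      rw [pow_succ']; group
  have htyt : t * y * t = y ^ 2 := by rw [hty, mul_assoc, ht, mul_one]
  have htD : ∀ d ∈ D, t * d * t ∈ D := by
    intro d hd
    obtain ⟨k, -, rfl⟩ := exists_lt_of_mem_zpowers (by norm_num) hy hd
    have h := conj_pow (i := k) (a := t) (b := y)
    rw [htinv, htyt] at h
    rw [← h]
    exact D.pow_mem (D.pow_mem hyD 2) k
  -- `P` has to be checked on the six nontrivial powers of `x`. The relation (x t)³ = 1 gives `P x`;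
  -- conjugation by `y` squares powers of `x`, reaching exponents 1, 2, 4, and inversion gives 6, 5,
  -- 3.
  let P : E → Prop := fun u => ∃ u' ∈ X, ∃ d ∈ D, ∃ v ∈ X, t * u * t = u' * d * t * v
  have hP1 : P x := by
    refine ⟨x⁻¹, X.inv_mem hxX, 1, D.one_mem, x⁻¹, X.inv_mem hxX, ?_⟩
    have h : x * t * (x * t) * (x * t) = 1 := by rw [← hxt, pow_succ, pow_two]
    have h2 : t * x * t = x⁻¹ * (x * t * (x * t) * (x * t)) * t⁻¹ * x⁻¹ := by group
    rw [h2, h, htinv]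
  have hPinv : ∀ u, P u → P u⁻¹ := by
    rintro u ⟨u', hu', d, hd, v, hv, h⟩
    refine ⟨v⁻¹, X.inv_mem hv, t * d⁻¹ * t, htD _ (D.inv_mem hd), u'⁻¹, X.inv_mem hu', ?_⟩
    have h2 : t * u⁻¹ * t = (t * u * t)⁻¹ := by rw [mul_inv_rev, mul_inv_rev, htinv, mul_assoc]
    rw [h2, h]
    simp only [mul_inv_rev, mul_assoc, htinv]
    rw [← mul_assoc t t, ht, one_mul]
  have hPconj : ∀ u, P u → P (y * u * y⁻¹) := by
    rintro u ⟨u', hu', d, hd, v, hv, h⟩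
    have e1 : t * y = y⁻¹ * t := by rw [hyinv, hty]
    have e2 : y⁻¹ * t = t * y := e1.symm
    have h3 : t * (y * u * y⁻¹) * t = (y⁻¹ * u' * y⁻¹⁻¹) * (y⁻¹ * d * y⁻¹) * t *
        (y⁻¹ * v * y⁻¹⁻¹) := by
      calc t * (y * u * y⁻¹) * t = (t * y) * u * (y⁻¹ * t) := by group
        _ = y⁻¹ * (t * u * t) * y := by rw [e2]; nth_rewrite 1 [e1]; group
        _ = y⁻¹ * u' * d * t * v * y := by rw [h]; group
        _ = y⁻¹ * u' * d * (t * y) * (y⁻¹ * v * y) := by group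
        _ = _ := by rw [e1]; group
    exact ⟨_, hDX _ (D.inv_mem hyD) u' hu', _, D.mul_mem (D.mul_mem (D.inv_mem hyD) hd)
      (D.inv_mem hyD), _, hDX _ (D.inv_mem hyD) v hv, h3⟩
  have hP2 : P (x ^ 2) := hyxy ▸ hPconj _ hP1
  have hP4 : P (x ^ 4) := by
    have h := hPconj _ hP2
    rwa [← conj_pow, hyxy, ← pow_mul] at h
  have hP' : ∀ k l, k + l = 7 → P (x ^ k) → P (x ^ l) := by
    intro k l hkl h
    have : x ^ l = (x ^ k)⁻¹ := eq_inv_of_mul_eq_one_right (by rw [← pow_add, hkl, hx])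
    exact this ▸ hPinv _ h
  have hX : ∀ u ∈ X, u ≠ 1 → P u := by
    intro u hu hu1
    obtain ⟨k, hk, rfl⟩ := exists_lt_of_mem_zpowers (by norm_num) hx hu
    interval_cases k
    · simp at hu1
    · simpa using hP1
    · exact hP2
    · exact hP' 4 3 rfl hP4
    · exact hP4
    · exact hP' 2 5 rfl hP2
    · exact hP' 1 6 rfl (by simpa using hP1)
  obtain ⟨hf, hc⟩ := finite_and_card_closure_le X D t ht htD hDX hX
  refine ⟨_, hf, hc.trans ?_, Subgroup.subset_closure (Or.inl (Or.inl hxX)),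
    Subgroup.subset_closure (Or.inl (Or.inr hyD)), Subgroup.subset_closure (Or.inr rfl)⟩
  calc Nat.card X * Nat.card D * (1 + Nat.card X) ≤ 7 * 3 * (1 + 7) := by gcongr
    _ = 168 := by norm_num

theorem exists_section_of_generators {r : ℕ} {R F : Type*} [CommRing R] [Field F] [Finite F]
    (c : R →+* F) (K : Subgroup (GL (Fin r) R)) [Finite K]
    (hcard : Nat.card K ≤ Nat.card (GL (Fin r) F))
    (hT : ∀ i j : Fin r, i ≠ j → ∀ a : F, ∃ g ∈ K,
      c.mapMatrix g.1 = Matrix.transvection i j a)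
    (hD : ∀ d : Fin r → F, (∀ i, d i ≠ 0) → ∃ g ∈ K,
      c.mapMatrix g.1 = Matrix.diagonal d) :
    ∃ s : GL (Fin r) F →* GL (Fin r) R, ∀ g, c.mapMatrix (s g).1 = g.1 := by
  obtain ⟨s, hs⟩ := exists_section_of_card_le (Matrix.GeneralLinearGroup.map c) K
    (eq_top_of_transvection_mem _
      (fun i j hij a => by
        obtain ⟨g, hg, h⟩ := hT i j hij a
        exact ⟨_, Subgroup.mem_map_of_mem _ hg, h⟩)
      (fun d hd => by
        obtain ⟨g, hg, h⟩ := hD d hd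
        exact ⟨_, Subgroup.mem_map_of_mem _ hg, h⟩)) hcard
  exact ⟨s, fun g => congrArg Units.val (hs g)⟩

/-- The letters 0, 1, 2 are the reductions modulo 2 of the generators x, y, t of
`exists_klein_subgroup`; these words show that the lifted subgroup maps onto GL₃(2). -/
theorem exists_word_eq_transvection (i j : Fin 3) (hij : i ≠ j) :
    ∃ l : List (Fin 3), (l.map ![!![0, 0, 1; 1, 0, 1; 0, 1, 0], !![0, 1, 1; 1, 1, 1; 0, 0, 1],
      !![0, 1, 1; 1, 0, 1; 0, 0, 1]]).prod = Matrix.transvection i j (1 : ZMod 2) := by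
  fin_cases i <;> fin_cases j
  · exact absurd rfl hij
  · exact ⟨[2, 1], by decide +kernel⟩
  · exact ⟨[1, 2, 0, 0, 0, 2, 0], by decide +kernel⟩
  · exact ⟨[0, 1, 2, 0, 0, 0, 2], by decide +kernel⟩
  · exact absurd rfl hij
  · exact ⟨[0, 2, 0, 1, 0, 0], by decide +kernel⟩
  · exact ⟨[0, 0, 2, 0, 1, 0], by decide +kernel⟩
  · exact ⟨[0, 1, 0, 2, 0, 2], by decide +kernel⟩
  · exact absurd rfl hij

-- With α = (-1+√-7)/2 these matrices give Klein's three-dimensional representation of PSL₂(7) ≅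
-- GL₃(2): the traces of x, y, t are α, 0, -1. The condition `c α = 0` selects the prime above 2 at
-- which to reduce.
set_option maxHeartbeats 1000000 in
theorem exists_klein_subgroup {R : Type*} [CommRing R] (c : R →+* ZMod 2) (α : R)
    (hα : α ^ 2 + α + 2 = 0) (hcα : c α = 0) :
    ∃ K : Subgroup (GL (Fin 3) R), Finite K ∧ Nat.card K ≤ 168 ∧ ∃ x ∈ K, ∃ y ∈ K, ∃ t ∈ K,
      c.mapMatrix x.1 = !![0, 0, 1; 1, 0, 1; 0, 1, 0] ∧
      c.mapMatrix y.1 = !![0, 1, 1; 1, 1, 1; 0, 0, 1] ∧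
      c.mapMatrix t.1 = !![0, 1, 1; 1, 0, 1; 0, 0, 1] := by
  let x : GL (Fin 3) R := ⟨!![0, 0, 1; 1, 0, 1 + α; 0, 1, α], !![-1 - α, 1, 0; -α, 0, 1; 1, 0, 0],
    by rw [Matrix.mul_fin_three, Matrix.one_fin_three]; congr! 3 <;> grind,
    by rw [Matrix.mul_fin_three, Matrix.one_fin_three]; congr! 3 <;> grind⟩
  let y : GL (Fin 3) R :=
    ⟨!![2 + α, -3, 1 - α; 1 + 2 * α, -3 - α, 1 - α; 2 * α, -2 - 2 * α, 1],
      !![3 + α, -3 - 2 * α, 2 + 2 * α; 3 + 2 * α, -2 - 3 * α, 1 + 3 * α; 2 + 2 * α, -2 * α,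
        -1 + 2 * α],
    by rw [Matrix.mul_fin_three, Matrix.one_fin_three]; congr! 3 <;> grind,
    by rw [Matrix.mul_fin_three, Matrix.one_fin_three]; congr! 3 <;> grind⟩
  let t : GL (Fin 3) R := ⟨!![0, 1, -1 + α; 1, 0, -1 + α; 0, 0, -1],
    !![0, 1, -1 + α; 1, 0, -1 + α; 0, 0, -1],
    by rw [Matrix.mul_fin_three, Matrix.one_fin_three]; congr! 3 <;> grind,
    by rw [Matrix.mul_fin_three, Matrix.one_fin_three]; congr! 3 <;> grind⟩
  have hx2 : (x ^ 2).1 = !![0, 1, α; 0, 1 + α, -1; 1, α, -1] := by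
    rw [pow_two]
    change !![0, 0, 1; 1, 0, 1 + α; 0, 1, α] * !![0, 0, 1; 1, 0, 1 + α; 0, 1, α] = _
    rw [Matrix.mul_fin_three]; congr! 3 <;> grind
  have hx3 : (x ^ 3).1 = !![1, α, -1; 1 + α, -1, -1; α, -1, -1 - α] := by
    rw [pow_succ, Units.val_mul, hx2]
    change _ * !![0, 0, 1; 1, 0, 1 + α; 0, 1, α] = _
    rw [Matrix.mul_fin_three]; congr! 3 <;> grind
  have hx : x ^ 7 = 1 := by
    have h : x ^ 7 = x * (x ^ 3 * x ^ 3) := by rw [← pow_add, ← pow_succ']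
    have h6 : x ^ 3 * x ^ 3 = x⁻¹ := by
      refine Units.ext ?_
      rw [Units.val_mul, hx3]
      change _ = !![-1 - α, 1, 0; -α, 0, 1; 1, 0, 0]
      rw [Matrix.mul_fin_three]; congr! 3 <;> grind
    rw [h, h6, mul_inv_cancel]
  have hy : y ^ 3 = 1 := by
    have h2 : y * y = y⁻¹ := by
      refine Units.ext ?_
      change !![2 + α, -3, 1 - α; 1 + 2 * α, -3 - α, 1 - α; 2 * α, -2 - 2 * α, 1] *
        !![2 + α, -3, 1 - α; 1 + 2 * α, -3 - α, 1 - α; 2 * α, -2 - 2 * α, 1] =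
        !![3 + α, -3 - 2 * α, 2 + 2 * α; 3 + 2 * α, -2 - 3 * α, 1 + 3 * α; 2 + 2 * α, -2 * α,
        -1 + 2 * α]
      rw [Matrix.mul_fin_three]; congr! 3 <;> grind
    rw [pow_succ, pow_two, h2, inv_mul_cancel]
  have ht : t * t = 1 := mul_eq_one_iff_eq_inv.2 (Units.ext rfl)
  have hyx : y * x = x ^ 2 * y := by
    refine Units.ext ?_
    rw [Units.val_mul, Units.val_mul, hx2]
    change !![2 + α, -3, 1 - α; 1 + 2 * α, -3 - α, 1 - α; 2 * α, -2 - 2 * α, 1] *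
      !![0, 0, 1; 1, 0, 1 + α; 0, 1, α] =
      _ * !![2 + α, -3, 1 - α; 1 + 2 * α, -3 - α, 1 - α; 2 * α, -2 - 2 * α, 1]
    rw [Matrix.mul_fin_three, Matrix.mul_fin_three]; congr! 3 <;> grind
  have hty : t * y = y ^ 2 * t := by
    have h2 : y ^ 2 = y⁻¹ := eq_inv_of_mul_eq_one_left (by rw [← pow_succ, hy])
    rw [h2]
    refine Units.ext ?_
    change !![0, 1, -1 + α; 1, 0, -1 + α; 0, 0, -1] *
      !![2 + α, -3, 1 - α; 1 + 2 * α, -3 - α, 1 - α; 2 * α, -2 - 2 * α, 1] =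
      !![3 + α, -3 - 2 * α, 2 + 2 * α; 3 + 2 * α, -2 - 3 * α, 1 + 3 * α; 2 + 2 * α, -2 * α,
        -1 + 2 * α] * !![0, 1, -1 + α; 1, 0, -1 + α; 0, 0, -1]
    rw [Matrix.mul_fin_three, Matrix.mul_fin_three]; congr! 3 <;> grind
  have hxt : (x * t) ^ 3 = 1 := by
    have h1 : (x * t).1 = !![0, 0, -1; 0, 1, -2; 1, 0, -1] := by
      change !![0, 0, 1; 1, 0, 1 + α; 0, 1, α] * !![0, 1, -1 + α; 1, 0, -1 + α; 0, 0, -1] = _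
      rw [Matrix.mul_fin_three]; congr! 3 <;> grind
    refine Units.ext ?_
    rw [pow_succ, pow_two, Units.val_mul, Units.val_mul, h1, Units.val_one, Matrix.mul_fin_three,
      Matrix.mul_fin_three, Matrix.one_fin_three]
    congr! 3 <;> grind
  obtain ⟨K, hKf, hKc, hxK, hyK, htK⟩ := finite_and_card_le_of_klein_relations hx hy ht hyx hty hxt
  have hc2 : c 2 = 0 := (map_ofNat c 2).trans (by decide)
  have hc3 : c 3 = 1 := (map_ofNat c 3).trans (by decide)
  refine ⟨K, hKf, hKc, x, hxK, y, hyK, t, htK, ?_, ?_, ?_⟩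
  · ext i j; fin_cases i <;> fin_cases j <;> simp [x, hcα]
  · ext i j; fin_cases i <;> fin_cases j <;> simp [y, hcα, hc2, hc3]
  · ext i j; fin_cases i <;> fin_cases j <;> simp [t, hcα]

theorem exists_section_two_three {R : Type*} [CommRing R] (c : R →+* ZMod 2) (α : R)
    (hα : α ^ 2 + α + 2 = 0) (hcα : c α = 0) :
    ∃ s : GL (Fin 3) (ZMod 2) →* GL (Fin 3) R,
      ∀ g, c.mapMatrix (s g).1 = g.1 := by
  have htwo : ∀ a : ZMod 2, a = 0 ∨ a = 1 := by decide
  obtain ⟨K, hKf, hKc, x, hxK, y, hyK, t, htK, hcx, hcy, hct⟩ := exists_klein_subgroup c α hα hcα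
  refine exists_section_of_generators c K ?_ ?_ ?_
  · refine hKc.trans (le_of_eq ?_)
    rw [Matrix.card_GL_field]
    simp [Fin.prod_univ_three, ZMod.card]
  · intro i j hij a
    rcases htwo a with rfl | rfl
    · exact ⟨1, K.one_mem, by simp [Matrix.transvection]⟩
    · obtain ⟨l, hl⟩ := exists_word_eq_transvection i j hij
      refine ⟨(l.map ![x, y, t]).prod, K.list_prod_mem ?_, ?_⟩
      · intro g hg
        obtain ⟨k, -, rfl⟩ := List.mem_map.1 hg
        fin_cases k
        exacts [hxK, hyK, htK]
      · rw [← hl]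
        clear hl
        induction l with
        | nil => simp
        | cons k l ih =>
          rw [List.map_cons, List.map_cons, List.prod_cons, List.prod_cons, Units.val_mul,
            map_mul, ih]
          congr 1
          fin_cases k
          exacts [hcx, hcy, hct]
  · intro d hd
    refine ⟨1, K.one_mem, ?_⟩
    have : d = fun _ => 1 := funext fun i => (htwo (d i)).resolve_left (hd i)
    rw [this, Matrix.diagonal_one, Units.val_one, map_one]

end SmallSections

/-! ### Lifting GL₂(2) and GL₂(3), and Hensel roots -/

section SmallSectionsRankTwo

/-- GL₂(2) is S₃, lifted by its integral reflection representation; `x` and `t` are two reflections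
with product of order 3. The torus is trivial here, hence `⊥` in the role of `D`. -/
theorem exists_section_two_two {R : Type*} [CommRing R] (c : R →+* ZMod 2) :
    ∃ s : GL (Fin 2) (ZMod 2) →* GL (Fin 2) R, ∀ g, c.mapMatrix (s g).1 = g.1 := by
  let x : GL (Fin 2) R := ⟨!![1, 1; 0, -1], !![1, 1; 0, -1],
    by simp [Matrix.one_fin_two], by simp [Matrix.one_fin_two]⟩
  let t : GL (Fin 2) R := ⟨!![0, -1; -1, 0], !![0, -1; -1, 0],
    by simp [Matrix.one_fin_two], by simp [Matrix.one_fin_two]⟩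
  have hx : x ^ 2 = 1 := by rw [pow_two]; exact mul_eq_one_iff_eq_inv.2 (Units.ext rfl)
  have ht : t * t = 1 := mul_eq_one_iff_eq_inv.2 (Units.ext rfl)
  have htxt : t * x * t = x * 1 * t * x := by
    refine Units.ext ?_
    change !![0, -1; -1, 0] * !![1, 1; 0, -1] * !![0, -1; -1, 0] =
      !![1, 1; 0, -1] * 1 * !![0, -1; -1, 0] * !![1, 1; 0, -1]
    simp
  obtain ⟨hXf, hXc⟩ := finite_and_card_zpowers_le (by norm_num) hx
  set X := Subgroup.zpowers x
  have hxX : x ∈ X := Subgroup.mem_zpowers x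
  obtain ⟨hf, hc⟩ := finite_and_card_closure_le X ⊥ t ht
    (by
      intro d hd
      rw [Subgroup.mem_bot] at hd ⊢
      rw [hd, mul_one, ht])
    (by
      intro d hd u hu
      rw [Subgroup.mem_bot] at hd
      simpa [hd] using hu)
    (by
      intro u hu hu1
      obtain ⟨k, hk, rfl⟩ := exists_lt_of_mem_zpowers (by norm_num) hx hu
      interval_cases k
      · simp at hu1
      · exact ⟨x, hxX, 1, one_mem _, x, hxX, by rw [pow_one]; exact htxt⟩)
  have htwo : ∀ a : ZMod 2, a = 0 ∨ a = 1 := by decide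
  set K := Subgroup.closure (X ∪ (⊥ : Subgroup (GL (Fin 2) R)) ∪ {t} : Set (GL (Fin 2) R))
  have hxK : x ∈ K := Subgroup.subset_closure (Or.inl (Or.inl hxX))
  have htK : t ∈ K := Subgroup.subset_closure (Or.inr rfl)
  have hcx : c.mapMatrix x.1 = !![1, 1; 0, 1] := by
    ext i j; fin_cases i <;> fin_cases j <;> simp [x]
  have hct : c.mapMatrix t.1 = !![0, 1; 1, 0] := by
    ext i j; fin_cases i <;> fin_cases j <;> simp [t]
  refine exists_section_of_generators c K ?_ ?_ ?_
  · refine hc.trans ?_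
    rw [Matrix.card_GL_field, Subgroup.card_bot]
    have : Nat.card X * 1 * (1 + Nat.card X) ≤ 2 * 1 * (1 + 2) := by gcongr
    simpa [Fin.prod_univ_two, ZMod.card] using this
  · intro i j hij a
    rcases htwo a with rfl | rfl
    · exact ⟨1, K.one_mem, by simp [Matrix.transvection]⟩
    · fin_cases i <;> fin_cases j
      · exact absurd rfl hij
      · exact ⟨x, hxK, by rw [hcx]; decide +kernel⟩
      · refine ⟨t * x * t, K.mul_mem (K.mul_mem htK hxK) htK, ?_⟩
        rw [Units.val_mul, Units.val_mul, map_mul, map_mul, hcx, hct]; decide +kernel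
      · exact absurd rfl hij
  · intro d hd
    refine ⟨1, K.one_mem, ?_⟩
    have : d = fun _ => 1 := funext fun i => (htwo (d i)).resolve_left (hd i)
    rw [this, Matrix.diagonal_one, Units.val_one, map_one]

/-- Diagonal matrices with entries `±1`. -/
def diagSigns (r : ℕ) (R : Type*) [CommRing R] : (Fin r → ℤˣ) →* GL (Fin r) R :=
  (Units.map ((Matrix.diagonalRingHom (Fin r) R).comp
    ((Int.castRingHom R).compLeft (Fin r))).toMonoidHom).comp
      (MulEquiv.piUnits (M := fun _ : Fin r => ℤ)).symm.toMonoidHom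

theorem val_diagSigns {r : ℕ} {R : Type*} [CommRing R] (ε : Fin r → ℤˣ) :
    (diagSigns r R ε).1 = Matrix.diagonal fun i => ((ε i : ℤ) : R) := rfl

/-- A faithful two-dimensional representation of GL₂(3) is defined over ℤ[1/2, √-2]; here `h` is 1/2
and `α` is √-2. Modulo 3, `x` becomes the transvection 1 + e₀₁ and the sign matrices become the
whole diagonal torus. -/
theorem exists_section_three_two {R : Type*} [CommRing R] (c : R →+* ZMod 3) (h α : R)
    (hh : 2 * h = 1) (hα : α ^ 2 + 2 = 0) (hcα : c α = 1) :
    ∃ s : GL (Fin 2) (ZMod 3) →* GL (Fin 2) R, ∀ g, c.mapMatrix (s g).1 = g.1 := by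
  let x : GL (Fin 2) R := ⟨!![-h, h * (1 + α); -h * (1 - α), -h],
    !![-h, -h * (1 + α); h * (1 - α), -h],
    by rw [Matrix.mul_fin_two, Matrix.one_fin_two]; congr! 3 <;> grind,
    by rw [Matrix.mul_fin_two, Matrix.one_fin_two]; congr! 3 <;> grind⟩
  let t : GL (Fin 2) R := ⟨!![0, 1; 1, 0], !![0, 1; 1, 0],
    by simp [Matrix.one_fin_two], by simp [Matrix.one_fin_two]⟩
  have hx : x ^ 3 = 1 := by
    have h2 : x * x = x⁻¹ := by
      refine Units.ext ?_
      change !![-h, h * (1 + α); -h * (1 - α), -h] * !![-h, h * (1 + α); -h * (1 - α), -h] =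
        !![-h, -h * (1 + α); h * (1 - α), -h]
      rw [Matrix.mul_fin_two]; congr! 3 <;> grind
    rw [pow_succ, pow_two, h2, inv_mul_cancel]
  have ht : t * t = 1 := mul_eq_one_iff_eq_inv.2 (Units.ext rfl)
  have htinv : t⁻¹ = t := inv_eq_of_mul_eq_one_left ht
  have hdiag : ∀ ε : Fin 2 → ℤˣ, (diagSigns 2 R ε).1 = !![((ε 0 : ℤ) : R), 0; 0, ((ε 1 : ℤ) : R)] :=
    fun ε => by rw [val_diagSigns]; ext i j; fin_cases i <;> fin_cases j <;> simp
  have htxt : t * x * t = x * diagSigns 2 R ![-1, 1] * t * x := by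
    refine Units.ext ?_
    simp only [Units.val_mul, hdiag]
    change !![0, 1; 1, 0] * !![-h, h * (1 + α); -h * (1 - α), -h] * !![0, 1; 1, 0] =
      !![-h, h * (1 + α); -h * (1 - α), -h] * !![((-1 : ℤ) : R), 0; 0, ((1 : ℤ) : R)] *
        !![0, 1; 1, 0] * !![-h, h * (1 + α); -h * (1 - α), -h]
    simp only [Matrix.mul_fin_two, Int.cast_neg, Int.cast_one]; congr! 3 <;> grind
  set D := (diagSigns 2 R).range
  have htdt : ∀ ε, t * diagSigns 2 R ε * t = diagSigns 2 R ![ε 1, ε 0] := by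
    intro ε
    refine Units.ext ?_
    simp only [Units.val_mul, hdiag]
    change !![0, 1; 1, 0] * _ * !![0, 1; 1, 0] = _
    simp
  have hdx : ∀ ε, diagSigns 2 R ε * x * (diagSigns 2 R ε)⁻¹ = x ∨
      diagSigns 2 R ε * x * (diagSigns 2 R ε)⁻¹ = x⁻¹ := by
    intro ε
    rw [mul_inv_eq_iff_eq_mul, mul_inv_eq_iff_eq_mul]
    have e : ∀ u : ℤˣ, u = 1 ∨ u = -1 := Int.units_eq_one_or
    rcases e (ε 0) with h0 | h0 <;> rcases e (ε 1) with h1 | h1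
    · left
      refine Units.ext ?_
      simp only [Units.val_mul, hdiag, h0, h1]
      change _ * !![-h, h * (1 + α); -h * (1 - α), -h] =
        !![-h, h * (1 + α); -h * (1 - α), -h] * _
      simp
    · right
      refine Units.ext ?_
      simp only [Units.val_mul, hdiag, h0, h1]
      change _ * !![-h, h * (1 + α); -h * (1 - α), -h] =
        !![-h, -h * (1 + α); h * (1 - α), -h] * _
      simp
    · right
      refine Units.ext ?_
      simp only [Units.val_mul, hdiag, h0, h1]
      change _ * !![-h, h * (1 + α); -h * (1 - α), -h] =
        !![-h, -h * (1 + α); h * (1 - α), -h] * _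
      simp
    · left
      refine Units.ext ?_
      simp only [Units.val_mul, hdiag, h0, h1]
      change _ * !![-h, h * (1 + α); -h * (1 - α), -h] =
        !![-h, h * (1 + α); -h * (1 - α), -h] * _
      simp
  obtain ⟨hXf, hXc⟩ := finite_and_card_zpowers_le (by norm_num) hx
  set X := Subgroup.zpowers x
  have hxX : x ∈ X := Subgroup.mem_zpowers x
  have hDf : Finite D := Finite.of_surjective _ (diagSigns 2 R).rangeRestrict_surjective
  have hDc : Nat.card D ≤ 4 := by
    refine (Nat.card_le_card_of_surjective _ (diagSigns 2 R).rangeRestrict_surjective).trans ?_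
    simp
  have htD : ∀ d ∈ D, t * d * t ∈ D := by
    rintro _ ⟨ε, rfl⟩
    exact ⟨_, (htdt ε).symm⟩
  obtain ⟨hf, hc⟩ := finite_and_card_closure_le X D t ht htD
    (by
      rintro _ ⟨ε, rfl⟩ u hu
      obtain ⟨k, hk, rfl⟩ := exists_lt_of_mem_zpowers (by norm_num) hx hu
      rw [← conj_pow]
      refine X.pow_mem ?_ k
      rcases hdx ε with h | h <;> rw [h]
      · exact hxX
      · exact X.inv_mem hxX)
    (by
      intro u hu hu1
      obtain ⟨k, hk, rfl⟩ := exists_lt_of_mem_zpowers (by norm_num) hx hu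
      interval_cases k
      · simp at hu1
      · exact ⟨x, hxX, _, ⟨_, rfl⟩, x, hxX, by rw [pow_one]; exact htxt⟩
      · refine ⟨x⁻¹, X.inv_mem hxX, _, htD _ (D.inv_mem ⟨![-1, 1], rfl⟩), x⁻¹,
          X.inv_mem hxX, ?_⟩
        have h2 : x ^ 2 = x⁻¹ := eq_inv_of_mul_eq_one_left (by rw [← pow_succ, hx])
        have h3 : t * x⁻¹ * t = (t * x * t)⁻¹ := by
          rw [mul_inv_rev, mul_inv_rev, htinv, mul_assoc]
        rw [h2, h3, htxt]
        simp only [mul_inv_rev, mul_assoc, htinv]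
        rw [← mul_assoc t t, ht, one_mul])
  set K := Subgroup.closure (X ∪ D ∪ {t} : Set (GL (Fin 2) R))
  have hxK : x ∈ K := Subgroup.subset_closure (Or.inl (Or.inl hxX))
  have htK : t ∈ K := Subgroup.subset_closure (Or.inr rfl)
  have hch : c h = 2 := by
    have h1 : 2 * c h = 1 := by rw [← map_one c, ← hh, map_mul, map_ofNat]
    revert h1; generalize c h = a; revert a; decide
  have hcx : c.mapMatrix x.1 = !![1, 1; 0, 1] := by
    ext i j; fin_cases i <;> fin_cases j <;> simp [x, hch, hcα] <;> decide
  have hct : c.mapMatrix t.1 = !![0, 1; 1, 0] := by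
    ext i j; fin_cases i <;> fin_cases j <;> simp [t]
  have hthree : ∀ a : ZMod 3, ∃ k : ℕ, !![1, 1; 0, 1] ^ k = Matrix.transvection 0 1 a ∧
      !![0, 1; 1, 0] * !![1, 1; 0, 1] ^ k * !![0, 1; 1, 0] =
        Matrix.transvection (1 : Fin 2) 0 a := by
    intro a
    refine ⟨a.val, ?_⟩
    revert a
    decide +kernel
  refine exists_section_of_generators c K ?_ ?_ ?_
  · refine hc.trans ?_
    rw [Matrix.card_GL_field]
    have : Nat.card X * Nat.card D * (1 + Nat.card X) ≤ 3 * 4 * (1 + 3) := by gcongr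
    simpa [Fin.prod_univ_two, ZMod.card] using this
  · intro i j hij a
    obtain ⟨k, hk1, hk2⟩ := hthree a
    fin_cases i <;> fin_cases j
    · exact absurd rfl hij
    · exact ⟨x ^ k, K.pow_mem hxK k, by rw [Units.val_pow_eq_pow_val, map_pow, hcx]; exact hk1⟩
    · refine ⟨t * x ^ k * t, K.mul_mem (K.mul_mem htK (K.pow_mem hxK k)) htK, ?_⟩
      rw [Units.val_mul, Units.val_mul, Units.val_pow_eq_pow_val, map_mul, map_mul, map_pow, hcx,
        hct]
      exact hk2
    · exact absurd rfl hij
  · intro d hd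
    have hsign : ∀ a : ZMod 3, a ≠ 0 → ∃ u : ℤˣ, ((u : ℤ) : ZMod 3) = a := by decide
    choose ε hε using fun i => hsign (d i) (hd i)
    refine ⟨diagSigns 2 R ε, Subgroup.subset_closure (Or.inl (Or.inr ⟨ε, rfl⟩)), ?_⟩
    rw [val_diagSigns]
    ext i j
    by_cases hij : i = j
    · subst hij; simp [hε]
    · simp [Matrix.diagonal_apply_ne _ hij]

/-- Hensel lifting: the derivative 2a + 1 is ≡ -1 modulo 2, so adding 2 ^ (n + 1) times the quotient
`q` is the Newton correction. -/
theorem exists_root_two (n : ℕ) : ∃ a : ℤ, (2 : ℤ) ∣ a ∧ (2 : ℤ) ^ (n + 1) ∣ a ^ 2 + a + 2 := by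
  induction n with
  | zero => exact ⟨0, by norm_num, by norm_num⟩
  | succ n ih =>
    obtain ⟨a, ⟨b, rfl⟩, ⟨q, hq⟩⟩ := ih
    refine ⟨2 * b + 2 ^ (n + 1) * q, ⟨b + 2 ^ n * q, by ring⟩, ⟨q * (2 * b + 1) + 2 ^ n * q ^ 2, ?_⟩⟩
    linear_combination hq

/-- The same correction works because the derivative 2a is ≡ -1 modulo 3 when a ≡ 1. -/
theorem exists_root_three (n : ℕ) :
    ∃ a : ℤ, (3 : ℤ) ∣ a - 1 ∧ (3 : ℤ) ^ (n + 1) ∣ a ^ 2 + 2 := by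
  induction n with
  | zero => exact ⟨1, by norm_num, by norm_num⟩
  | succ n ih =>
    obtain ⟨a, ⟨b, hb⟩, ⟨q, hq⟩⟩ := ih
    obtain rfl : a = 3 * b + 1 := by omega
    refine ⟨3 * b + 1 + 3 ^ (n + 1) * q, ⟨b + 3 ^ n * q, by ring⟩,
      ⟨q * (2 * b + 1) + 3 ^ n * q ^ 2, ?_⟩⟩
    linear_combination hq

theorem exists_section_zmod_two_three {n : ℕ} (hd : 2 ∣ 2 ^ n) :
    ∃ s : GL (Fin 3) (ZMod 2) →* GL (Fin 3) (ZMod (2 ^ n)),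
      ∀ g, (ZMod.castHom hd (ZMod 2)).mapMatrix (s g).1 = g.1 := by
  obtain ⟨a, ha, hroot⟩ := exists_root_two n
  refine exists_section_two_three _ (a : ZMod (2 ^ n)) ?_ ?_
  · have h : ((a ^ 2 + a + 2 : ℤ) : ZMod (2 ^ n)) = 0 := by
      rw [ZMod.intCast_zmod_eq_zero_iff_dvd]
      push_cast
      exact (pow_dvd_pow 2 n.le_succ).trans hroot
    simpa using h
  · rw [map_intCast]
    exact (ZMod.intCast_zmod_eq_zero_iff_dvd a 2).2 ha

theorem exists_section_zmod_three_two {n : ℕ} (hd : 3 ∣ 3 ^ n) :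
    ∃ s : GL (Fin 2) (ZMod 3) →* GL (Fin 2) (ZMod (3 ^ n)),
      ∀ g, (ZMod.castHom hd (ZMod 3)).mapMatrix (s g).1 = g.1 := by
  obtain ⟨a, ha, hroot⟩ := exists_root_three n
  obtain ⟨k, hk⟩ : Odd (3 ^ n) := Odd.pow (by decide)
  refine exists_section_three_two _ ((k + 1 : ℕ) : ZMod (3 ^ n)) (a : ZMod (3 ^ n)) ?_ ?_ ?_
  · have h : ((2 * k + 1 : ℕ) : ZMod (3 ^ n)) = 0 := by rw [← hk]; exact ZMod.natCast_self _
    push_cast at h ⊢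
    linear_combination h
  · have h : ((a ^ 2 + 2 : ℤ) : ZMod (3 ^ n)) = 0 := by
      rw [ZMod.intCast_zmod_eq_zero_iff_dvd]
      push_cast
      exact (pow_dvd_pow 3 n.le_succ).trans hroot
    simpa using h
  · rw [map_intCast]
    have h := (ZMod.intCast_zmod_eq_zero_iff_dvd (a - 1) 3).2 ha
    push_cast at h
    exact sub_eq_zero.1 h

end SmallSectionsRankTwo

/-! ### No lift of GL_r modulo p² for p = 3, r ≥ 3 and p = 2, r ≥ 4 -/

section Nonsplitting

/-- The transvection `1 + a e_{ij}` as an invertible matrix. -/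
def transvectionGL {r : ℕ} {F : Type*} [CommRing F] {i j : Fin r} (hij : i ≠ j) (a : F) :
    GL (Fin r) F :=
  ⟨Matrix.transvection i j a, Matrix.transvection i j (-a),
    by rw [Matrix.transvection_mul_transvection_same _ _ hij, add_neg_cancel, Matrix.transvection_zero],
    by rw [Matrix.transvection_mul_transvection_same _ _ hij, neg_add_cancel, Matrix.transvection_zero]⟩

theorem transvectionGL_mul {r : ℕ} {F : Type*} [CommRing F] {i j : Fin r} (hij : i ≠ j) (a b : F) :
    transvectionGL hij a * transvectionGL hij b = transvectionGL hij (a + b) :=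
  Units.ext (Matrix.transvection_mul_transvection_same _ _ hij a b)

theorem transvectionGL_pow {r p : ℕ} {i j : Fin r} (hij : i ≠ j) :
    transvectionGL hij (1 : ZMod p) ^ p = 1 := by
  have h : ∀ k : ℕ, transvectionGL hij (1 : ZMod p) ^ k = transvectionGL hij (k : ZMod p) := by
    intro k
    induction k with
    | zero =>
      refine Units.ext ?_
      simp [transvectionGL]
    | succ k ih => rw [pow_succ, ih, transvectionGL_mul, Nat.cast_succ]
  rw [h, ZMod.natCast_self]
  exact Units.ext (Matrix.transvection_zero i j)

theorem commute_transvectionGL {r : ℕ} {F : Type*} [CommRing F] {i j k l : Fin r} (hij : i ≠ j)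
    (hkl : k ≠ l) (hjk : j ≠ k) (hli : l ≠ i) (a b : F) :
    transvectionGL hij a * transvectionGL hkl b = transvectionGL hkl b * transvectionGL hij a := by
  refine Units.ext ?_
  simp only [transvectionGL, Units.val_mul, Matrix.transvection, add_mul, mul_add,
    one_mul, mul_one, Matrix.single_mul_single_of_ne _ _ _ _ hjk,
    Matrix.single_mul_single_of_ne _ _ _ _ hli]
  abel

theorem single_one_mul_apply {r : ℕ} {R : Type*} [CommRing R] (i j a b : Fin r)
    (M : Matrix (Fin r) (Fin r) R) :
    (Matrix.single i j (1 : R) * M) a b = if a = i then M j b else 0 := by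
  split_ifs with h
  · subst h; simp
  · simp [Matrix.single_mul_apply_of_ne _ _ _ _ _ h]

theorem mul_single_one_apply {r : ℕ} {R : Type*} [CommRing R] (i j a b : Fin r)
    (M : Matrix (Fin r) (Fin r) R) :
    (M * Matrix.single i j (1 : R)) a b = if b = j then M a i else 0 := by
  split_ifs with h
  · subst h; simp
  · simp [Matrix.mul_single_apply_of_ne _ _ _ _ _ h]

theorem exists_eq_add_nsmul_of_mapMatrix_eq {p n r : ℕ} [NeZero (p ^ n)] (hd : p ∣ p ^ n)
    {A B : Matrix (Fin r) (Fin r) (ZMod (p ^ n))}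
    (h : (ZMod.castHom hd (ZMod p)).mapMatrix A = (ZMod.castHom hd (ZMod p)).mapMatrix B) :
    ∃ X, A = B + p • X := by
  have key : ∀ a : ZMod (p ^ n), ZMod.castHom hd (ZMod p) a = 0 → ∃ x, a = p • x := by
    intro a ha
    rw [← ZMod.natCast_zmod_val a, map_natCast, ZMod.natCast_eq_zero_iff] at ha
    obtain ⟨k, hk⟩ := ha
    refine ⟨k, ?_⟩
    rw [nsmul_eq_mul, ← Nat.cast_mul, ← hk, ZMod.natCast_zmod_val]
  have h2 : ∀ i j, ∃ x, A i j - B i j = p • x := fun i j => key _ (by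
    rw [map_sub, sub_eq_zero]
    exact congrFun (congrFun h i) j)
  choose X hX using h2
  refine ⟨Matrix.of X, ?_⟩
  ext i j
  rw [Matrix.add_apply, Matrix.smul_apply, Matrix.of_apply, ← hX]
  abel

theorem exists_section_transvection {p n r : ℕ} [NeZero (p ^ n)] (hd : p ∣ p ^ n)
    {s : GL (Fin r) (ZMod p) →* Matrix (Fin r) (Fin r) (ZMod (p ^ n))}
    (hs : ∀ g, (ZMod.castHom hd (ZMod p)).mapMatrix (s g) = g.1) {i j : Fin r} (hij : i ≠ j) :
    ∃ X, s (transvectionGL hij 1) = 1 + Matrix.single i j 1 + p • X := by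
  refine exists_eq_add_nsmul_of_mapMatrix_eq hd ?_
  rw [hs]
  simp only [transvectionGL, Matrix.transvection, map_add, map_one]
  congr 1
  ext a b
  simp [Matrix.single_apply]

theorem one_add_mul_one_add {A : Type*} [Ring A] {p : ℕ} (hp : ∀ a : A, (p * p) • a = 0)
    {E F X Y : A} (hEF : E * F = 0) :
    (1 + E + p • X) * (1 + F + p • Y) = 1 + (E + F) + p • (X + Y + E * Y + X * F) := by
  have h := hp (X * Y)
  rw [mul_nsmul'] at h
  simp only [add_mul, mul_add, one_mul, mul_one, hEF, nsmul_add, smul_mul_assoc, mul_smul_comm, h]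
  abel

/-- Put W = N + 3Z. Since 9 = 0 and N² = 0, one has 3W = 3N, 3W² = 0 and W³ = 3NZN. The cubic term
survives, so one element of order 3 gives no contradiction by itself. -/
theorem nsmul_add_eq_zero_of_pow_three_eq_one {A : Type*} [Ring A]
    (h9 : ∀ a : A, (3 * 3) • a = 0) {N Z : A} (hN : N * N = 0) (h : (1 + N + 3 • Z) ^ 3 = 1) :
    3 • (N + N * Z * N) = 0 := by
  have h9' : ∀ a : A, 3 • 3 • a = 0 := fun a => by rw [← mul_nsmul', h9]
  have h2 : (N + 3 • Z) * (N + 3 • Z) = 3 • (N * Z + Z * N) := by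
    simp only [add_mul, mul_add, hN, nsmul_add, smul_mul_assoc, mul_smul_comm, h9']
    abel
  have h3 : (N + 3 • Z) * (N + 3 • Z) * (N + 3 • Z) = 3 • (N * Z * N) := by
    rw [h2]
    simp only [add_mul, mul_add, mul_assoc, hN, nsmul_add, smul_mul_assoc, mul_smul_comm, h9',
      mul_zero, smul_zero, add_zero]
  have h4 : (1 + N + 3 • Z) ^ 3 = 1 + 3 • N + 3 • 3 • Z + 3 • ((N + 3 • Z) * (N + 3 • Z)) +
      (N + 3 • Z) * (N + 3 • Z) * (N + 3 • Z) := by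
    generalize 3 • Z = V
    noncomm_ring
  rw [h4, h3, h2, h9', h9', add_zero, add_zero, add_assoc, ← nsmul_add] at h
  simpa using h

/-- The cube condition is applied to the commuting transvections g, h and to g h and g h². The
conditions for g and h fix X_ji and Y_ki modulo 3. Those for g h and g h² then involve the same
unknown Y_ji + X_ki, once and twice; eliminating it leaves 6 = 0 in ℤ/9. -/
theorem not_exists_section_three {r : ℕ} (hr : 3 ≤ r) (hd : 3 ∣ 3 ^ 2)
    (s : GL (Fin r) (ZMod 3) →* Matrix (Fin r) (Fin r) (ZMod (3 ^ 2)))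
    (hs : ∀ g, (ZMod.castHom hd (ZMod 3)).mapMatrix (s g) = g.1) : False := by
  have hNZ : NeZero (3 ^ 2) := ⟨by norm_num⟩
  obtain ⟨i, j, k, hij, hik, hjk⟩ : ∃ i j k : Fin r, i ≠ j ∧ i ≠ k ∧ j ≠ k :=
    ⟨⟨0, by omega⟩, ⟨1, by omega⟩, ⟨2, by omega⟩, by simp, by simp, by simp⟩
  have h9 : ∀ M : Matrix (Fin r) (Fin r) (ZMod (3 ^ 2)), (3 * 3) • M = 0 := by
    intro M
    ext a b
    rw [Matrix.smul_apply, nsmul_eq_mul]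
    exact mul_eq_zero_of_left (by decide) _
  obtain ⟨X, hX⟩ := exists_section_transvection hd hs hij
  obtain ⟨Y, hY⟩ := exists_section_transvection hd hs hik
  set g := transvectionGL hij (1 : ZMod 3)
  set h := transvectionGL hik (1 : ZMod 3)
  set E : Matrix (Fin r) (Fin r) (ZMod (3 ^ 2)) := Matrix.single i j 1
  set F : Matrix (Fin r) (Fin r) (ZMod (3 ^ 2)) := Matrix.single i k 1
  have hEE : E * E = 0 := Matrix.single_mul_single_of_ne _ _ _ _ hij.symm _
  have hEF : E * F = 0 := Matrix.single_mul_single_of_ne _ _ _ _ hij.symm _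
  have hFE : F * E = 0 := Matrix.single_mul_single_of_ne _ _ _ _ hik.symm _
  have hFF : F * F = 0 := Matrix.single_mul_single_of_ne _ _ _ _ hik.symm _
  have hcomm : Commute g h := commute_transvectionGL hij hik hij.symm hik.symm _ _
  have hg : g ^ 3 = 1 := transvectionGL_pow hij
  have hh : h ^ 3 = 1 := transvectionGL_pow hik
  have cube : ∀ (u : GL (Fin r) (ZMod 3)) (N Z : Matrix (Fin r) (Fin r) (ZMod (3 ^ 2))),
      u ^ 3 = 1 → N * N = 0 → s u = 1 + N + 3 • Z → 3 • (N + N * Z * N) = 0 := by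
    intro u N Z hu hN hsu
    have h1 : (1 + N + 3 • Z) ^ 3 = 1 := by rw [← hsu, ← map_pow, hu, map_one]
    exact nsmul_add_eq_zero_of_pow_three_eq_one h9 hN h1
  have hgh : s (g * h) = _ := (map_mul s g h).trans
    ((congrArg₂ (· * ·) hX hY).trans (one_add_mul_one_add h9 hEF))
  have hhh : s (h * h) = _ := (map_mul s h h).trans
    ((congrArg₂ (· * ·) hY hY).trans (one_add_mul_one_add h9 hFF))
  have hghh : s (g * (h * h)) = _ := (map_mul s g (h * h)).trans
    ((congrArg₂ (· * ·) hX hhh).trans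
      (one_add_mul_one_add h9 (by rw [mul_add, hEF, add_zero])))
  have c1 := cube _ _ _ hg hEE hX
  have c2 := cube _ _ _ hh hFF hY
  have c3 := cube _ _ _ (by rw [hcomm.mul_pow, hg, hh, one_mul])
    (by simp [mul_add, add_mul, hEE, hEF, hFE, hFF]) hgh
  have c4 := cube _ _ _ (by
      rw [(hcomm.mul_right hcomm).mul_pow, hg, (Commute.refl h).mul_pow, hh, one_mul, one_mul])
    (by simp [mul_add, add_mul, hEE, hEF, hFE, hFF]) hghh
  have d1 := congrFun (congrFun c1 i) j
  have d2 := congrFun (congrFun c2 i) k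
  have d3 := congrFun (congrFun c3 i) j
  have d4 := congrFun (congrFun c4 i) j
  simp only [E, F, mul_add, add_mul, Matrix.add_apply, Matrix.smul_apply, Matrix.zero_apply,
    single_one_mul_apply, mul_single_one_apply, Matrix.single_apply, hik, hjk, hij.symm,
    hik.symm, hjk.symm, if_true, if_false, nsmul_eq_mul, and_self, and_false] at d1 d2 d3 d4
  have : (6 : ZMod (3 ^ 2)) = 0 := by
    push_cast at d1 d2 d3 d4
    linear_combination -d4 + 2 * d3 - d1 + 2 * d2
  exact absurd this (by decide)

theorem nsmul_add_eq_zero_of_mul_self_eq_one {A : Type*} [Ring A]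
    (h4 : ∀ a : A, (2 * 2) • a = 0) {N Z : A} (hN : N * N = 0)
    (h : (1 + N + 2 • Z) * (1 + N + 2 • Z) = 1) : 2 • (N + (N * Z + Z * N)) = 0 := by
  have h5 := h4 Z
  rw [one_add_mul_one_add h4 hN, add_assoc, add_eq_left] at h
  rw [← h]
  rw [mul_nsmul'] at h5
  rw [show Z + Z + N * Z + Z * N = 2 • Z + (N * Z + Z * N) by abel, nsmul_add _ _ 2,
    nsmul_add (2 • Z), h5, zero_add, two_nsmul N]

theorem nsmul_add_eq_of_mul_eq_mul {A : Type*} [Ring A] (h4 : ∀ a : A, (2 * 2) • a = 0)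
    {M N Y Z : A} (hMN : M * N = 0) (hNM : N * M = 0)
    (h : (1 + M + 2 • Y) * (1 + N + 2 • Z) = (1 + N + 2 • Z) * (1 + M + 2 • Y)) :
    2 • (M * Z + Y * N) = 2 • (N * Y + Z * M) := by
  rw [one_add_mul_one_add h4 hMN, one_add_mul_one_add h4 hNM] at h
  rw [add_comm N M, add_right_inj, add_comm Z Y, add_assoc (Y + Z), add_assoc (Y + Z), nsmul_add,
    nsmul_add (Y + Z), add_right_inj] at h
  exact h

/-- The square of the lift at (i,k) forces X_ii + X_kk to be odd. Commutation relations between the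
transvections at (i,k), (i,l), (j,k), (j,l) force it to be even: modulo 2, X_ii - X_ll = Y_kl, X_jj
- X_kk = Z_ji, X_jj = X_ll and Y_kl + Z_ji = 0. -/
theorem not_exists_section_two {r : ℕ} (hr : 4 ≤ r) (hd : 2 ∣ 2 ^ 2)
    (s : GL (Fin r) (ZMod 2) →* Matrix (Fin r) (Fin r) (ZMod (2 ^ 2)))
    (hs : ∀ g, (ZMod.castHom hd (ZMod 2)).mapMatrix (s g) = g.1) : False := by
  have hNZ : NeZero (2 ^ 2) := ⟨by norm_num⟩
  obtain ⟨i, j, k, l, hij, hik, hil, hjk, hjl, hkl⟩ : ∃ i j k l : Fin r,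
      i ≠ j ∧ i ≠ k ∧ i ≠ l ∧ j ≠ k ∧ j ≠ l ∧ k ≠ l :=
    ⟨⟨0, by omega⟩, ⟨1, by omega⟩, ⟨2, by omega⟩, ⟨3, by omega⟩, by simp, by simp, by simp,
      by simp, by simp, by simp⟩
  have h4 : ∀ M : Matrix (Fin r) (Fin r) (ZMod (2 ^ 2)), (2 * 2) • M = 0 := by
    intro M
    ext a b
    rw [Matrix.smul_apply, nsmul_eq_mul]
    exact mul_eq_zero_of_left (by decide) _
  obtain ⟨X, hX⟩ := exists_section_transvection hd hs hik
  obtain ⟨Y, hY⟩ := exists_section_transvection hd hs hil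
  obtain ⟨Z, hZ⟩ := exists_section_transvection hd hs hjk
  obtain ⟨W, hW⟩ := exists_section_transvection hd hs hjl
  have comm : ∀ {a b c d : Fin r} (hab : a ≠ b) (hcd : c ≠ d), b ≠ c → d ≠ a →
      ∀ M N : Matrix (Fin r) (Fin r) (ZMod (2 ^ 2)),
      s (transvectionGL hab 1) = 1 + Matrix.single a b 1 + 2 • M →
      s (transvectionGL hcd 1) = 1 + Matrix.single c d 1 + 2 • N →
      2 • (Matrix.single a b 1 * N + M * Matrix.single c d 1) =
        2 • (Matrix.single c d 1 * M + N * Matrix.single a b 1) := by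
    intro a b c d hab hcd hbc hda M N hM hN
    refine nsmul_add_eq_of_mul_eq_mul h4 (Matrix.single_mul_single_of_ne _ _ _ _ hbc _)
      (Matrix.single_mul_single_of_ne _ _ _ _ hda _) ?_
    rw [← hM, ← hN, ← map_mul, ← map_mul, commute_transvectionGL hab hcd hbc hda]
  have c1 := nsmul_add_eq_zero_of_mul_self_eq_one h4
    (Matrix.single_mul_single_of_ne _ _ _ _ hik.symm _)
    (by rw [← hX, ← map_mul, ← pow_two, transvectionGL_pow hik, map_one])
  have d1 := congrFun (congrFun c1 i) k
  have d2 := congrFun (congrFun (comm hik hjl hjk.symm hil.symm X W hX hW) j) l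
  have d3 := congrFun (congrFun (comm hik hil hik.symm hil.symm X Y hX hY) i) l
  have d4 := congrFun (congrFun (comm hik hjk hjk.symm hik.symm X Z hX hZ) j) k
  have d5 := congrFun (congrFun (comm hil hjk hjl.symm hik.symm Y Z hY hZ) j) l
  simp only [Matrix.add_apply, Matrix.smul_apply, Matrix.zero_apply,
    single_one_mul_apply, mul_single_one_apply, Matrix.single_apply, hij.symm, hkl.symm,
    if_true, if_false, nsmul_eq_mul, and_self] at d1 d2 d3 d4 d5
  have : (2 : ZMod (2 ^ 2)) = 0 := by
    have h0 : (4 : ZMod (2 ^ 2)) = 0 := by decide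
    push_cast at d1 d2 d3 d4 d5
    linear_combination d1 - d3 + d2 - d4 - d5 - (X k k + Z j i) * h0
  exact absurd this (by decide)

end Nonsplitting

/-! ### The cases in which λ has a section -/

section HomocyclicSections

theorem exists_lam_section_of_exponent_one {p r : ℕ} (hp : p.Prime) {H : Type*} [AddCommGroup H]
    (h : IsHomocyclic p 1 r H) : ∃ s : Aut (ModP p H) →* Aut H, ∀ u, lam p H (s u) = u := by
  have hinj : Function.Injective (lam p H) := by
    rw [injective_iff_map_eq_one]
    intro u hu
    refine Units.ext (AddMonoidHom.ext fun x => ?_)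
    have h1 : endModP p H u.1 = 1 := congrArg Units.val hu
    have h2 : (QuotientAddGroup.mk (u.1 x) : ModP p H) = QuotientAddGroup.mk x :=
      DFunLike.congr_fun h1 (QuotientAddGroup.mk x)
    obtain ⟨y, hy⟩ := mem_pMul.1 (QuotientAddGroup.eq.1 h2.symm)
    have h0 := h.nsmul_eq_zero y
    rw [pow_one, hy] at h0
    exact (neg_add_eq_zero.1 h0).symm
  let F := MulEquiv.ofBijective _ ⟨hinj, lam_surjective hp h⟩
  exact ⟨F.symm.toMonoidHom, fun u => F.apply_symm_apply u⟩

/-- Teichmüller lift: the p ^ n-th power of any preimage depends only on the class, because Aut H is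
commutative and p ^ n kills the kernel. It still lifts u, since u ^ p ^ n = u by Fermat. -/
theorem exists_lam_section_of_rank_one {p n : ℕ} (hp : p.Prime) {H : Type*} [AddCommGroup H]
    (h : IsHomocyclic p n 1 H) : ∃ s : Aut (ModP p H) →* Aut H, ∀ u, lam p H (s u) = u := by
  have : Fact p.Prime := ⟨hp⟩
  obtain ⟨Φ, Ψ, hΨ⟩ := exists_matrix_coordinates hp (dvd_pow_self p h.1.ne') h
  have hcomm : ∀ a b : Aut H, Commute a b := by
    refine fun a b => Units.ext (Φ.injective ?_)
    rw [Units.val_mul, Units.val_mul, map_mul, map_mul]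
    ext i j
    rw [Subsingleton.elim i j, Matrix.mul_apply, Matrix.mul_apply]
    exact Finset.sum_congr rfl fun k _ => by rw [Subsingleton.elim k j, mul_comm]
  have hpow : ∀ u : Aut (ModP p H), u ^ p ^ n = u := by
    refine fun u => Units.ext (Ψ.injective ?_)
    have hdiag : Ψ u.1 = Matrix.diagonal fun _ => Ψ u.1 0 0 := by
      ext i j
      rw [Subsingleton.elim i j, Subsingleton.elim j 0, Matrix.diagonal_apply_eq]
    rw [Units.val_pow_eq_pow_val, map_pow, hdiag, Matrix.diagonal_pow]
    exact congrArg _ (funext fun _ => ZMod.pow_card_pow _)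
  obtain ⟨g, hg⟩ := (lam_surjective hp h).hasRightInverse
  have key : ∀ a b : Aut H, lam p H a = lam p H b → a ^ p ^ n = b ^ p ^ n := by
    intro a b hab
    have h1 := pow_eq_one_of_lam_eq_one h (u := a * b⁻¹)
      (by rw [map_mul, map_inv, hab, mul_inv_cancel])
    rw [(hcomm a b⁻¹).mul_pow, inv_pow] at h1
    exact mul_inv_eq_one.1 h1
  refine ⟨MonoidHom.mk' (fun u => g u ^ p ^ n) fun u v => ?_, fun u => ?_⟩
  · rw [← (hcomm _ _).mul_pow]
    exact key _ _ (by rw [map_mul, hg, hg, hg])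
  · change lam p H (g u ^ p ^ n) = u
    rw [map_pow, hg, hpow]

theorem exists_lam_section {p n r : ℕ} (hp : p.Prime) {H : Type*} [AddCommGroup H]
    (h : IsHomocyclic p n r H)
    (hcase : n = 1 ∨ r = 1 ∨ (p = 2 ∧ r ≤ 3) ∨ (p = 3 ∧ r ≤ 2)) :
    ∃ s : Aut (ModP p H) →* Aut H, ∀ u, lam p H (s u) = u := by
  have hd : p ∣ p ^ n := dvd_pow_self p h.1.ne'
  have hr : 0 < r := h.2.1
  by_cases hr1 : r = 1
  · subst hr1
    exact exists_lam_section_of_rank_one hp h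
  have of_section : (∃ s : GL (Fin r) (ZMod p) →* GL (Fin r) (ZMod (p ^ n)),
      ∀ g, (ZMod.castHom hd (ZMod p)).mapMatrix (s g).1 = g.1) →
      ∃ s : Aut (ModP p H) →* Aut H, ∀ u, lam p H (s u) = u := fun ⟨s, hs⟩ =>
    exists_lam_section_of_matrix hp hd h ((Units.coeHom _).comp s) hs
  rcases hcase with rfl | hr1' | ⟨rfl, hr3⟩ | ⟨rfl, hr2⟩
  · exact exists_lam_section_of_exponent_one hp h
  · exact absurd hr1' hr1
  · obtain rfl | rfl : r = 2 ∨ r = 3 := by omega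
    · exact of_section (exists_section_two_two _)
    · exact of_section (exists_section_zmod_two_three hd)
  · obtain rfl : r = 2 := by omega
    exact of_section (exists_section_zmod_three_two hd)

end HomocyclicSections

/-! ### Block-diagonal assembly of sections -/

section DirectSums

variable {ι : Type*} [LinearOrder ι] {G : ι → Type*} [∀ i, AddCommGroup (G i)]
  {p : ℕ} {n r : ι → ℕ}

theorem exists_sigma_section (hp : p.Prime) (hG : ∀ i, IsHomocyclic p (n i) (r i) (G i))
    (hn : StrictMono n)
    (h : ∀ i, ∃ s : Aut (ModP p (G i)) →* Aut (G i), ∀ u, lam p (G i) (s u) = u) :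
    ∃ s : (∀ i, Aut (ModP p (G i))) →* Aut (⨁ i, G i), ∀ u, sigma hp hG hn (s u) = u := by
  choose s hs using h
  let F : (∀ i, Aut (ModP p (G i))) →* AddMonoid.End (⨁ i, G i) :=
    { toFun := fun u => DirectSum.map fun i => ((s i (u i)).1 : G i →+ G i)
      map_one' := AddMonoidHom.ext fun x => DFinsupp.ext fun i => by
        change (s i 1).1 (x i) = x i
        rw [map_one]; rfl
      map_mul' := fun u v => AddMonoidHom.ext fun x => DFinsupp.ext fun i => by
        change (s i (u i * v i)).1 (x i) = (s i (u i)).1 ((s i (v i)).1 (x i))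
        rw [map_mul]; rfl }
  refine ⟨F.toHomUnits, fun u => ?_⟩
  ext i : 1
  refine Eq.trans ?_ (hs i (u i))
  apply Units.ext
  change endModP p (G i) _ = endModP p (G i) _
  refine congrArg (endModP p (G i)) (AddMonoidHom.ext fun x => ?_)
  exact (congrArg (fun y : ⨁ i, G i => y i)
    (DirectSum.map_of (fun i => ((s i (u i)).1 : G i →+ G i)) i x)).trans (DirectSum.of_eq_same i _)

end DirectSums

theorem IsHomocyclic.exists_pow_nsmul_eq {p n r : ℕ} (hp : p.Prime) {H : Type*} [AddCommGroup H]
    (h : IsHomocyclic p n r H) {k m : ℕ} (hkm : k + m ≤ n) {x : H} (hx : p ^ k • x = 0) :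
    ∃ y, p ^ m • y = x := by
  induction m with
  | zero => exact ⟨x, by simp⟩
  | succ m ih =>
    obtain ⟨y, rfl⟩ := ih (by omega)
    rw [← mul_nsmul', ← pow_add] at hx
    obtain ⟨z, rfl⟩ := mem_pMul.1 (h.mem_pMul_of_nsmul_eq_zero hp (by omega) hx)
    exact ⟨z, by rw [pow_succ, mul_nsmul']⟩

/-! ### Exponent gaps of at least two: reduction modulo p² -/

section WideGaps

variable {ι : Type*} [LinearOrder ι] {G : ι → Type*} [∀ i, AddCommGroup (G i)]
  {p : ℕ} {n r : ι → ℕ}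

/-- The difference is the sum of the detours G_i → G_j → G_i with j ≠ i. A homomorphism from a
smaller exponent to one larger by at least 2 has image in p² times its target: this is the second
leg if j < i and the first if j > i. -/
theorem block_mul_sub_mem_sq (hp : p.Prime) (hG : ∀ i, IsHomocyclic p (n i) (r i) (G i))
    (hn : ∀ i j, i < j → n i + 2 ≤ n j) (B A : AddMonoid.End (⨁ i, G i)) (i : ι) (g : G i) :
    block (B * A) i i g - block B i i (block A i i g) ∈ pMul (p ^ 2) (G i) := by
  classical
  set x : ⨁ i, G i := A (DirectSum.of G i g) with hx
  have h1 : block (B * A) i i g - block B i i (block A i i g)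
      = (∑ j ∈ DFinsupp.support x, B (DirectSum.of G j (x j)) i) -
        B (DirectSum.of G i (x i)) i := by
    have h2 : (∑ j ∈ DFinsupp.support x, B (DirectSum.of G j (x j)) i) = B x i := by
      conv_rhs => rw [← DirectSum.sum_support_of x]
      rw [map_sum, DFinsupp.finsetSum_apply]
    rw [h2]
    rfl
  have hoff : ∀ j, j ≠ i → B (DirectSum.of G j (x j)) i ∈ pMul (p ^ 2) (G i) := by
    intro j hj
    rcases lt_or_gt_of_ne hj with hlt | hgt
    · refine mem_pMul.2 ((hG i).exists_pow_nsmul_eq hp (hn j i hlt) ?_)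
      rw [← block_apply, ← map_nsmul, (hG j).nsmul_eq_zero, map_zero]
    · rw [← block_apply]
      refine map_mem_pMul _ (mem_pMul.2 ((hG j).exists_pow_nsmul_eq hp (hn i j hgt) ?_))
      rw [hx, ← block_apply, ← map_nsmul, (hG i).nsmul_eq_zero, map_zero]
  rw [h1]
  by_cases hi : i ∈ DFinsupp.support x
  · rw [← Finset.add_sum_erase _ _ hi, add_sub_cancel_left]
    exact sum_mem fun j hj => hoff j (Finset.ne_of_mem_erase hj)
  · have h0 : x i = 0 := by simpa using hi
    rw [h0, map_zero, map_zero, DirectSum.zero_apply, sub_zero]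
    exact sum_mem fun j hj => hoff j (fun h => hi (h ▸ hj))

theorem mapMatrix_eq_zero_of_mem_sq {m k : ℕ} (hp : p.Prime) (hm : 2 ≤ m) {H : Type*}
    [AddCommGroup H] (hH : ∀ x : H, p ^ m • x = 0)
    (Φ : AddMonoid.End H ≃+* Matrix (Fin k) (Fin k) (ZMod (p ^ m)))
    {f : AddMonoid.End H} (hf : ∀ x, f x ∈ pMul (p ^ 2) H) :
    (ZMod.castHom (pow_dvd_pow p hm) (ZMod (p ^ 2))).mapMatrix (Φ f) = 0 := by
  have : NeZero (p ^ m) := ⟨pow_ne_zero _ hp.ne_zero⟩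
  have h0 : p ^ (m - 2) • f = 0 := by
    refine AddMonoidHom.ext fun x => ?_
    obtain ⟨y, hy⟩ := mem_pMul.1 (hf x)
    change p ^ (m - 2) • f x = 0
    rw [← hy, ← mul_nsmul', ← pow_add, Nat.sub_add_cancel hm, hH]
  have h1 : p ^ (m - 2) • Φ f = 0 := by rw [← map_nsmul, h0, map_zero]
  ext i j
  have h2 : p ^ (m - 2) • Φ f i j = 0 := congrFun (congrFun h1 i) j
  change ZMod.castHom (pow_dvd_pow p hm) (ZMod (p ^ 2)) (Φ f i j) = 0
  rw [← ZMod.natCast_zmod_val (Φ f i j)] at h2 ⊢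
  rw [nsmul_eq_mul, ← Nat.cast_mul, ZMod.natCast_eq_zero_iff] at h2
  rw [map_natCast, ZMod.natCast_eq_zero_iff]
  have h3 : p ^ m = p ^ (m - 2) * p ^ 2 := by rw [← pow_add, Nat.sub_add_cancel hm]
  exact Nat.dvd_of_mul_dvd_mul_left (pow_pos hp.pos _) (h3.symm.dvd.trans h2)

/-- The diagonal entry `A_{ii}` as an endomorphism of `G_i`. -/
def diagBlock (A : AddMonoid.End (⨁ i, G i)) (i : ι) : AddMonoid.End (G i) := block A i i

/-- The diagonal entry is multiplicative only modulo p², which is why the target is `ZMod (p ^ 2)`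
and not `ZMod (p ^ n i)`; the nonsplitting results need no more. -/
theorem exists_matrix_section_of_sigma_section (hp : p.Prime)
    (hG : ∀ i, IsHomocyclic p (n i) (r i) (G i)) (hn : StrictMono n)
    (hgap : ∀ i j, i < j → n i + 2 ≤ n j)
    (s : (∀ i, Aut (ModP p (G i))) →* Aut (⨁ i, G i)) (hs : ∀ u, sigma hp hG hn (s u) = u)
    (i : ι) (hi : 2 ≤ n i) (hd : p ∣ p ^ 2) :
    ∃ s : GL (Fin (r i)) (ZMod p) →* Matrix (Fin (r i)) (Fin (r i)) (ZMod (p ^ 2)),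
      ∀ g, (ZMod.castHom hd (ZMod p)).mapMatrix (s g) = g.1 := by
  have hdn : p ∣ p ^ n i := hd.trans (pow_dvd_pow p hi)
  obtain ⟨Φ, Ψ, hΨ⟩ := exists_matrix_coordinates hp hdn (hG i)
  let c := ZMod.castHom (pow_dvd_pow p hi) (ZMod (p ^ 2))
  let τ : AddMonoid.End (⨁ i, G i) →* Matrix (Fin (r i)) (Fin (r i)) (ZMod (p ^ 2)) :=
    { toFun := fun A => c.mapMatrix (Φ (diagBlock A i))
      map_one' := by
        have : diagBlock (1 : AddMonoid.End (⨁ i, G i)) i = 1 :=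
          AddMonoidHom.ext fun x => DirectSum.of_eq_same i x
        rw [this, map_one, map_one]
      map_mul' := fun B A => by
        rw [← map_mul, ← map_mul, ← sub_eq_zero, ← map_sub, ← map_sub]
        exact mapMatrix_eq_zero_of_mem_sq hp hi (hG i).nsmul_eq_zero Φ
          fun x => block_mul_sub_mem_sq hp hG hgap B A i x }
  refine ⟨τ.comp ((Units.coeHom _).comp (s.comp ((MonoidHom.mulSingle _ i).comp
    (Units.mapEquiv Ψ.toMulEquiv).symm.toMonoidHom))), fun g => ?_⟩
  set u := (Units.mapEquiv Ψ.toMulEquiv).symm g with hu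
  change (ZMod.castHom hd (ZMod p)).mapMatrix
    (c.mapMatrix (Φ (diagBlock (s (Pi.mulSingle i u)).1 i))) = g.1
  have h1 : ∀ M : Matrix (Fin (r i)) (Fin (r i)) (ZMod (p ^ n i)),
      (ZMod.castHom hd (ZMod p)).mapMatrix (c.mapMatrix M) =
        (ZMod.castHom hdn (ZMod p)).mapMatrix M := by
    intro M
    ext a b
    exact RingHom.congr_fun (ZMod.castHom_comp hd (pow_dvd_pow p hi)) (M a b)
  rw [h1, ← hΨ]
  have h2 : sigma hp hG hn (s (Pi.mulSingle i u)) i = u := by rw [hs, Pi.mulSingle_eq_same]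
  have h3 : endModP p (G i) (diagBlock (s (Pi.mulSingle i u)).1 i) = u.1 := congrArg Units.val h2
  rw [h3]
  exact congrArg Units.val ((Units.mapEquiv Ψ.toMulEquiv).apply_symm_apply g)

end WideGaps

/-- The element of (i, j] with least exponent is the immediate successor of i; it exists because
exponents are natural numbers. -/
theorem add_two_le_of_covBy {ι : Type*} [LinearOrder ι] {n : ι → ℕ} (hn : StrictMono n)
    (h : ∀ i j, i ⋖ j → 1 < (n j : ℤ) - n i) {i j : ι} (hij : i < j) : n i + 2 ≤ n j := by
  classical
  have hex : ∃ m, ∃ k, i < k ∧ k ≤ j ∧ n k = m := ⟨n j, j, hij, le_rfl, rfl⟩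
  obtain ⟨k, hik, hkj, hk⟩ := Nat.find_spec hex
  have hcov : i ⋖ k := ⟨hik, fun l hil hlk =>
    Nat.find_min hex (hk ▸ hn hlk) ⟨l, hil, hlk.le.trans hkj, rfl⟩⟩
  have h1 := h i k hcov
  have h2 := hn.monotone hkj
  omega

/-! ### Primes p ≥ 5: tracking powers of N through the summands -/

section Stages

variable {ι : Type*} [LinearOrder ι] {G : ι → Type*} [∀ i, AddCommGroup (G i)]

/-- The elements of `⨁ G_j` whose component at `i` lies in `a` and whose other components lie in
the subgroups `b j`. -/
def HasComponents (i : ι) (a : AddSubgroup (G i)) (b : ∀ j, AddSubgroup (G j)) (x : ⨁ j, G j) :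
    Prop :=
  x i ∈ a ∧ ∀ j, j ≠ i → x j ∈ b j

theorem apply_mem_of_block_mem (N : AddMonoid.End (⨁ j, G j)) (l : ι) (c : AddSubgroup (G l))
    (x : ⨁ j, G j) (h : ∀ j, block N j l (x j) ∈ c) : N x l ∈ c := by
  classical
  have h2 : N x l = ∑ j ∈ DFinsupp.support x, block N j l (x j) := by
    conv_lhs => rw [← DirectSum.sum_support_of x]
    rw [map_sum, DFinsupp.finsetSum_apply]
    rfl
  rw [h2]
  exact sum_mem fun j _ => h j

theorem HasComponents.map {i : ι} {a a' : AddSubgroup (G i)} {b b' : ∀ j, AddSubgroup (G j)}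
    {N : AddMonoid.End (⨁ j, G j)}
    (hii : ∀ x ∈ a, block N i i x ∈ a')
    (hij : ∀ j, j ≠ i → ∀ x ∈ a, block N i j x ∈ b' j)
    (hji : ∀ j, j ≠ i → ∀ x ∈ b j, block N j i x ∈ a')
    (hjl : ∀ j l, j ≠ i → l ≠ i → ∀ x ∈ b j, block N j l x ∈ b' l)
    {x : ⨁ j, G j} (hx : HasComponents i a b x) : HasComponents i a' b' (N x) := by
  refine ⟨apply_mem_of_block_mem N i _ x fun j => ?_, fun l hl =>
    apply_mem_of_block_mem N l _ x fun j => ?_⟩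
  · by_cases hj : j = i
    · subst hj; exact hii _ hx.1
    · exact hji j hj _ (hx.2 j hj)
  · by_cases hj : j = i
    · subst hj; exact hij l hl _ hx.1
    · exact hjl j l hj hl _ (hx.2 j hj)

theorem map_mem_pMul_mul {H K : Type*} [AddCommGroup H] [AddCommGroup K] (f : H →+ K) {a b c : ℕ}
    (hc : a * b = c) {x : H} (hx : x ∈ pMul a H) (hf : ∀ z, f z ∈ pMul b K) :
    f x ∈ pMul c K := by
  obtain ⟨z, rfl⟩ := mem_pMul.1 hx
  obtain ⟨w, hw⟩ := mem_pMul.1 (hf z)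
  exact mem_pMul.2 ⟨w, by rw [map_nsmul, ← hw, ← hc, mul_nsmul']⟩

theorem pMul_mono {H : Type*} [AddCommGroup H] {a b : ℕ} (h : a ∣ b) : pMul b H ≤ pMul a H := by
  obtain ⟨c, rfl⟩ := h
  rintro _ ⟨x, rfl⟩
  exact mem_pMul.2 ⟨c • x, (mul_nsmul' x a c).symm⟩

variable {p : ℕ} {n r : ι → ℕ}

/-- If `N` acts on each `G_j / pG_j`, `j ≠ i`, as zero and on `G_i / pG_i` with square zero, and
`(1 + N) ^ p = 1` for a prime `p ≥ 5`, then `N` acts on `G_i / pG_i` as zero. -/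
theorem block_mem_of_one_add_pow_eq_one (hp : p.Prime) (hp5 : 5 ≤ p)
    (hG : ∀ i, IsHomocyclic p (n i) (r i) (G i)) (hn : StrictMono n) (i : ι) {m : ℕ}
    (hm : n i = m + 2) (N : AddMonoid.End (⨁ j, G j))
    (hoff : ∀ j, j ≠ i → ∀ x, block N j j x ∈ pMul p (G j))
    (hsq : ∀ x, block N i i (block N i i x) ∈ pMul p (G i))
    (hN : (1 + N) ^ p = 1) (g : G i) : block N i i g ∈ pMul p (G i) := by
  have hom : ∀ {j l : ι} {t : ℕ}, n j + t ≤ n l → ∀ (f : G j →+ G l) (z : G j),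
      f z ∈ pMul (p ^ t) (G l) := fun {j l t} h f z =>
    mem_pMul.2 ((hG l).exists_pow_nsmul_eq hp h (by
      rw [← map_nsmul, (hG j).nsmul_eq_zero, map_zero]))
  have hom1 : ∀ {j l : ι}, n j + 1 ≤ n l → ∀ (f : G j →+ G l) (z : G j),
      f z ∈ pMul p (G l) := fun {j l} h f z => by simpa using hom h f z
  have kill : ∀ {j : ι} {k : ℕ}, n j ≤ k → ∀ x ∈ pMul (p ^ k) (G j), x = 0 := by
    intro j k hk x hx
    obtain ⟨z, rfl⟩ := mem_pMul.1 (pMul_mono (pow_dvd_pow p hk) hx)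
    exact (hG j).nsmul_eq_zero z
  have hpow1 : p ^ m * p = p ^ (m + 1) := (pow_succ p m).symm
  have hpow2 : p ^ (m + 1) * p = p ^ (m + 2) := (pow_succ p (m + 1)).symm
  have hpow3 : p ^ m * p ^ 2 = p ^ (m + 2) := (pow_add p m 2).symm
  -- `F` is preserved by all homomorphisms and receives every image of p ^ m G_i; `P` is killed by
  -- every homomorphism into G_i, of exponent p ^ (m + 2). `I` contains both pG_i and, by `hsq`, the
  -- image of N_ii.
  let F : ∀ j, AddSubgroup (G j) := fun j =>
    pMul (p ^ m) (G j) ⊓ (nsmulAddMonoidHom (p ^ 2) : G j →+ G j).ker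
  let P : ∀ j, AddSubgroup (G j) := fun j => pMul (p ^ (m + 2)) (G j)
  let I : AddSubgroup (G i) := (pMul p (G i)).comap (block N i i)
  have memF : ∀ {j} {y : G j}, y ∈ F j ↔ y ∈ pMul (p ^ m) (G j) ∧ p ^ 2 • y = 0 := Iff.rfl
  have mapF : ∀ {j l} (f : G j →+ G l), ∀ y ∈ F j, f y ∈ F l := fun f y hy =>
    memF.2 ⟨map_mem_pMul f (memF.1 hy).1, by rw [← map_nsmul, (memF.1 hy).2, map_zero]⟩
  have highF : ∀ {j} {k : ℕ}, k + 2 ≤ n j → ∀ y ∈ F j, y ∈ pMul (p ^ k) (G j) :=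
    fun {j k} hk y hy => mem_pMul.2 ((hG j).exists_pow_nsmul_eq hp (by omega) (memF.1 hy).2)
  have hcmp : ∀ j, j ≠ i → n j ≤ m + 1 ∨ m + 3 ≤ n j := by
    intro j hj
    have : n j ≠ n i := fun h => hj (hn.injective h)
    omega
  have F_to_i : ∀ j, j ≠ i → ∀ y ∈ F j, block N j i y ∈ pMul (p ^ (m + 1)) (G i) := by
    intro j hj y hy
    rcases hcmp j hj with h | h
    · exact map_mem_pMul_mul _ hpow1 (memF.1 hy).1 (hom1 (by omega) _)
    · exact map_mem_pMul _ (highF (by omega) y hy)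
  have i_to_P : ∀ j, j ≠ i → ∀ y ∈ pMul (p ^ (m + 1)) (G i), block N i j y ∈ P j := by
    intro j hj y hy
    rcases hcmp j hj with h | h
    · rw [kill h _ (map_mem_pMul _ hy)]; exact zero_mem _
    · exact map_mem_pMul_mul _ hpow2 hy (hom1 (by omega) _)
  -- No exponent other than n_i equals m + 2. In the tight cases n_l = m + 1 and n_j = m + 3 one
  -- extra factor p is needed; `hlt` takes it from the exponent gap, or from `hoff` when j = l.
  have F_to_P : ∀ j l, j ≠ i → l ≠ i → ∀ y ∈ F j, block N j l y ∈ P l := by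
    intro j l hj hl y hy
    have hdiag : n j = n l → ∀ z, block N j l z ∈ pMul p (G l) := by
      intro h z
      obtain rfl := hn.injective h
      exact hoff j hj z
    have hlt : n j ≤ n l → ∀ z, block N j l z ∈ pMul p (G l) := by
      intro h
      rcases h.eq_or_lt with h | h
      · exact hdiag h
      · exact hom1 h _
    have hqy := (memF.1 hy).1
    rcases hcmp j hj with h | h <;> rcases hcmp l hl with h' | h'
    · have h0 : block N j l y = 0 := by
        rcases h'.eq_or_lt with h1 | h1
        · exact kill h' _ (map_mem_pMul_mul _ hpow1 hqy (hlt (by omega)))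
        · exact kill (by omega : n l ≤ m) _ (map_mem_pMul _ hqy)
      rw [h0]; exact zero_mem _
    · exact map_mem_pMul_mul _ hpow3 hqy (hom (by omega) _)
    · rw [kill h' _ (map_mem_pMul _ (highF (by omega) y hy))]; exact zero_mem _
    · rcases h.eq_or_lt with h1 | h1
      · exact map_mem_pMul_mul _ hpow2 (highF (by omega) y hy) (hlt (by omega))
      · exact map_mem_pMul _ (highF (by omega) y hy)
  have P_to_i : ∀ j, j ≠ i → ∀ y ∈ P j, block N j i y = 0 := fun j _ y hy =>
    kill hm.le _ (map_mem_pMul _ hy)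
  have P_to_P : ∀ j l, j ≠ i → l ≠ i → ∀ y ∈ P j, block N j l y ∈ P l := fun j l _ _ y hy =>
    map_mem_pMul _ hy
  have hI : pMul p (G i) ≤ I := fun y hy => map_mem_pMul _ hy
  have pow_le : pMul (p ^ (m + 1)) (G i) ≤ I.map (nsmulAddMonoidHom (p ^ m)) := by
    rintro _ ⟨y, rfl⟩
    exact ⟨p • y, hI (mem_pMul.2 ⟨y, rfl⟩), by
      change p ^ m • p • y = p ^ (m + 1) • y
      rw [← mul_nsmul', hpow1]⟩
  have map_le : ∀ k, I.map (nsmulAddMonoidHom (p ^ k)) ≤ pMul (p ^ k) (G i) := by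
    rintro k _ ⟨y, -, rfl⟩
    exact mem_pMul.2 ⟨y, rfl⟩
  have qF : ∀ j, ∀ y ∈ pMul (p ^ m) (G i), block N i j y ∈ F j := by
    intro j y hy
    refine mapF (block N i j) y (memF.2 ⟨hy, ?_⟩)
    obtain ⟨z, rfl⟩ := mem_pMul.1 hy
    rw [← mul_nsmul', mul_comm, hpow3, ← hm, (hG i).nsmul_eq_zero]
  -- Successive applications of N move the i-component through p ^ m G_i, p ^ m I, p ^ (m + 1) G_i,
  -- p ^ (m + 1) G_i, p ^ (m + 1) I, 0. The third one leaves it in place but moves the other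
  -- components from `F` to `P`.
  have step0 : ∀ {x}, HasComponents i (pMul (p ^ m) (G i)) F x →
      HasComponents i (I.map (nsmulAddMonoidHom (p ^ m))) F (N x) := fun hx => hx.map
    (by
      rintro _ ⟨z, rfl⟩
      exact ⟨block N i i z, hsq z, (map_nsmul _ _ _).symm⟩)
    (fun j _ => qF j) (fun j hj y hy => pow_le (F_to_i j hj y hy)) (fun j l _ _ => mapF _)
  have step1 : ∀ {x}, HasComponents i (I.map (nsmulAddMonoidHom (p ^ m))) F x →
      HasComponents i (pMul (p ^ (m + 1)) (G i)) F (N x) := fun hx => hx.map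
    (by
      rintro _ ⟨z, hz, rfl⟩
      obtain ⟨w, hw⟩ := mem_pMul.1 hz
      refine mem_pMul.2 ⟨w, ?_⟩
      change _ = block N i i (p ^ m • z)
      rw [map_nsmul, ← hw, ← mul_nsmul', hpow1])
    (fun j _ y hy => qF j y (map_le m hy)) F_to_i (fun j l _ _ => mapF _)
  have step2 : ∀ {x}, HasComponents i (pMul (p ^ (m + 1)) (G i)) F x →
      HasComponents i (pMul (p ^ (m + 1)) (G i)) P (N x) := fun hx => hx.map
    (fun y hy => map_mem_pMul _ hy) i_to_P F_to_i F_to_P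
  have step3 : ∀ {x}, HasComponents i (pMul (p ^ (m + 1)) (G i)) P x →
      HasComponents i (I.map (nsmulAddMonoidHom (p ^ (m + 1)))) P (N x) := fun hx => hx.map
    (by
      rintro _ ⟨z, rfl⟩
      exact ⟨block N i i z, hsq z, (map_nsmul _ _ _).symm⟩)
    i_to_P (fun j hj y hy => by rw [P_to_i j hj y hy]; exact zero_mem _) P_to_P
  have step4 : ∀ {x}, HasComponents i (I.map (nsmulAddMonoidHom (p ^ (m + 1)))) P x →
      HasComponents i ⊥ P (N x) := fun hx => hx.map
    (by
      rintro _ ⟨z, hz, rfl⟩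
      obtain ⟨w, hw⟩ := mem_pMul.1 hz
      refine AddSubgroup.mem_bot.2 ?_
      change block N i i (p ^ (m + 1) • z) = 0
      rw [map_nsmul, ← hw, ← mul_nsmul', hpow2, ← hm, (hG i).nsmul_eq_zero])
    (fun j hj y hy => i_to_P j hj y (map_le _ hy))
    (fun j hj y hy => AddSubgroup.mem_bot.2 (P_to_i j hj y hy)) P_to_P
  have stay : ∀ (k : ℕ) {x}, HasComponents i ⊥ P x → HasComponents i ⊥ P ((N ^ k) x) := by
    intro k x hx
    induction k with
    | zero => exact hx
    | succ k ih =>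
      rw [pow_succ']
      exact ih.map (fun y hy => by rw [AddSubgroup.mem_bot.1 hy, map_zero]; exact zero_mem _)
        (fun j hj y hy => by rw [AddSubgroup.mem_bot.1 hy, map_zero]; exact zero_mem _)
        (fun j hj y hy => AddSubgroup.mem_bot.2 (P_to_i j hj y hy)) P_to_P
  -- On this vector the linear term contributes p ^ (m + 1) N_ii g; as n_i = m + 2, its vanishing
  -- says exactly that N_ii g lies in pG_i.
  set x₀ : ⨁ j, G j := DirectSum.of G i (p ^ m • g) with hx₀
  have hx₀i : x₀ i = p ^ m • g := DirectSum.of_eq_same i _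
  have hx₀j : ∀ j, j ≠ i → x₀ j = 0 := fun j hj => DirectSum.of_eq_of_ne i j _ hj
  have start : HasComponents i (pMul (p ^ m) (G i)) F x₀ :=
    ⟨mem_pMul.2 ⟨g, hx₀i.symm⟩, fun j hj => by rw [hx₀j j hj]; exact zero_mem _⟩
  have startp : HasComponents i (pMul (p ^ (m + 1)) (G i)) P (p • x₀) :=
    ⟨mem_pMul.2 ⟨g, by
      change _ = p • x₀ i
      rw [hx₀i, ← mul_nsmul', mul_comm, hpow1]⟩, fun j hj => by
      change p • x₀ j ∈ P j
      rw [hx₀j j hj, smul_zero]; exact zero_mem _⟩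
  have hfive : ∀ k, ((N ^ (k + 5)) x₀) i = 0 := fun k => by
    rw [pow_add]
    exact AddSubgroup.mem_bot.1 (stay k (step4 (step3 (step2 (step1 (step0 start)))))).1
  have htwo : ∀ k, ((N ^ (k + 2)) (p • x₀)) i = 0 := fun k => by
    rw [pow_add]
    exact AddSubgroup.mem_bot.1 (stay k (step4 (step3 startp))).1
  let ev : AddMonoid.End (⨁ j, G j) →+ G i :=
    { toFun := fun f => f x₀ i, map_zero' := rfl, map_add' := fun _ _ => rfl }
  have hsum := congrArg ev hN
  rw [add_comm, (Commute.one_right N).add_pow] at hsum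
  obtain ⟨q, hq⟩ : ∃ q, p = q + 2 := ⟨p - 2, by omega⟩
  have hterm : ∀ k ∈ Finset.range (q + 1),
      ev (N ^ (k + 2) * 1 ^ (p - (k + 2)) * (p.choose (k + 2) : AddMonoid.End _)) = 0 := by
    intro k hk
    have hk := Finset.mem_range.1 hk
    rw [one_pow, mul_one, ← nsmul_eq_mul', map_nsmul]
    -- The top term has coefficient 1 and vanishes because N ^ 5 already kills the i-component of
    -- `x₀`, which is where p ≥ 5 enters. The middle coefficients supply a factor p, and two
    -- applications of N suffice on p x₀.
    by_cases hk' : k + 2 = p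
    · obtain ⟨t, ht⟩ : ∃ t, k + 2 = t + 5 := ⟨k - 3, by omega⟩
      rw [ht]
      change _ • ((N ^ (t + 5)) x₀) i = 0
      rw [hfive, smul_zero]
    · obtain ⟨c, hc⟩ := hp.dvd_choose_self (by omega) (by omega : k + 2 < p)
      rw [hc, mul_comm, mul_nsmul']
      have h1 : p • ev (N ^ (k + 2)) = ((N ^ (k + 2)) (p • x₀)) i := by
        rw [map_nsmul]; rfl
      rw [h1, htwo, smul_zero]
  have hrange : p + 1 = q + 1 + 1 + 1 := by omega
  rw [map_sum, hrange, Finset.sum_range_succ', Finset.sum_range_succ', Finset.sum_eq_zero hterm]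
    at hsum
  have h1 : p • ev N = 0 := by
    rw [← map_nsmul, nsmul_eq_mul']
    simpa using hsum
  have h2 : p ^ (m + 1) • block N i i g = 0 := by
    have h3 : ev N = block N i i (p ^ m • g) := rfl
    rw [h3, map_nsmul, ← mul_nsmul', mul_comm, hpow1] at h1
    exact h1
  exact (hG i).mem_pMul_of_nsmul_eq_zero hp (by omega) h2

end Stages

/-! ### Primes p ≥ 5: exponent at least p² forces rank one -/

section LargePrimes

variable {ι : Type*} [LinearOrder ι] {G : ι → Type*} [∀ i, AddCommGroup (G i)]
  {p : ℕ} {n r : ι → ℕ}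

/-- In rank at least 2 there is a transvection u ≠ 1 with u ^ p = 1 and (u - 1)² = 0. Lifting the
family equal to u at i and 1 elsewhere gives N with all the hypotheses of
`block_mem_of_one_add_pow_eq_one`, whose conclusion is u = 1. -/
theorem rank_eq_one_of_sigma_section (hp : p.Prime) (hp5 : 5 ≤ p)
    (hG : ∀ i, IsHomocyclic p (n i) (r i) (G i)) (hn : StrictMono n)
    (s : (∀ i, Aut (ModP p (G i))) →* Aut (⨁ i, G i)) (hs : ∀ u, sigma hp hG hn (s u) = u)
    (i : ι) (hi : 2 ≤ n i) : r i = 1 := by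
  have : Fact p.Prime := ⟨hp⟩
  by_contra hr1
  have hr : 2 ≤ r i := by have := (hG i).2.1; omega
  have hdn : p ∣ p ^ n i := dvd_pow_self p (by omega)
  obtain ⟨Φ, Ψ, hΨ⟩ := exists_matrix_coordinates hp hdn (hG i)
  have h01 : (⟨0, by omega⟩ : Fin (r i)) ≠ ⟨1, by omega⟩ := by simp
  let g := transvectionGL h01 (1 : ZMod p)
  let u : Aut (ModP p (G i)) := (Units.mapEquiv Ψ.toMulEquiv).symm g
  have hΨu : Ψ u.1 = 1 + Matrix.single _ _ 1 :=
    congrArg Units.val ((Units.mapEquiv Ψ.toMulEquiv).apply_symm_apply g)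
  have hup : u ^ p = 1 := by
    rw [← map_pow, transvectionGL_pow h01, map_one]
  have husq : (u.1 - 1) * (u.1 - 1) = 0 := by
    apply Ψ.injective
    rw [map_mul, map_sub, hΨu, map_one, add_sub_cancel_left, map_zero]
    exact Matrix.single_mul_single_of_ne _ _ _ _ h01.symm _
  have hu1 : u.1 - 1 ≠ 0 := by
    intro h0
    have h1 := congrArg Ψ h0
    rw [map_sub, hΨu, map_one, add_sub_cancel_left, map_zero] at h1
    have h2 := congrFun (congrFun h1 ⟨0, by omega⟩) ⟨1, by omega⟩
    simp at h2
  let A := s (Pi.mulSingle i u)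
  have hA : ∀ j x, (QuotientAddGroup.mk (block A.1 j j x) : ModP p (G j)) =
      ((Pi.mulSingle i u : ∀ j, Aut (ModP p (G j))) j).1 (QuotientAddGroup.mk x) := by
    intro j x
    have h1 : sigma hp hG hn A j = (Pi.mulSingle i u : ∀ j, Aut (ModP p (G j))) j := by rw [hs]
    have h2 := congrArg Units.val h1
    exact DFunLike.congr_fun h2 (QuotientAddGroup.mk x)
  let N : AddMonoid.End (⨁ j, G j) := A.1 - 1
  have hNA : ∀ j x, block N j j x = block A.1 j j x - x := by
    intro j x
    have h1 : block N j j x = block A.1 j j x - (DirectSum.of G j x) j := rfl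
    rw [h1, DirectSum.of_eq_same]
  have hNi : ∀ x, (QuotientAddGroup.mk (block N i i x) : ModP p (G i)) =
      (u.1 - 1) (QuotientAddGroup.mk x) := by
    intro x
    have h1 := hA i x
    rw [Pi.mulSingle_eq_same] at h1
    rw [hNA, QuotientAddGroup.mk_sub, h1]
    rfl
  have hmk : ∀ j (x : G j), (QuotientAddGroup.mk x : ModP p (G j)) = 0 ↔ x ∈ pMul p (G j) :=
    fun j x => QuotientAddGroup.eq_zero_iff x
  have hN : (1 + N) ^ p = 1 := by
    have h1 : 1 + N = A.1 := add_sub_cancel _ _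
    have h2 : A ^ p = 1 := by
      rw [← map_pow, ← Pi.mulSingle_pow, hup, Pi.mulSingle_one, map_one]
    rw [h1, ← Units.val_pow_eq_pow_val, h2, Units.val_one]
  have main := block_mem_of_one_add_pow_eq_one hp hp5 hG hn i (m := n i - 2) (by omega) N
    (fun j hj x => by
      rw [← hmk, hNA, QuotientAddGroup.mk_sub, hA, Pi.mulSingle_eq_of_ne hj]
      exact sub_self _)
    (fun x => by
      rw [← hmk, hNi, hNi]
      exact DFunLike.congr_fun husq _)
    hN
  refine hu1 (AddMonoidHom.ext fun y => ?_)
  induction y using QuotientAddGroup.induction_on with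
  | H x => exact (hNi x).symm.trans ((hmk i _).2 (main x))

end LargePrimes

/-! ### Equivalence of the splittings and the semidirect product form -/

section Main

variable {ι : Type*} [LinearOrder ι] {G : ι → Type*} [∀ i, AddCommGroup (G i)]
  {p : ℕ} {n r : ι → ℕ}

theorem exists_sigma_section_iff (hp : p.Prime) (hG : ∀ i, IsHomocyclic p (n i) (r i) (G i))
    (hn : StrictMono n) (h : 5 ≤ p ∨ ∀ i j, i ⋖ j → 1 < (n j : ℤ) - n i) :
    (∃ s : (∀ i, Aut (ModP p (G i))) →* Aut (⨁ i, G i), ∀ u, sigma hp hG hn (s u) = u) ↔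
      ∀ i, ∃ s : Aut (ModP p (G i)) →* Aut (G i), ∀ u, lam p (G i) (s u) = u := by
  refine ⟨fun ⟨s, hs⟩ i => exists_lam_section hp (hG i) ?_, exists_sigma_section hp hG hn⟩
  by_cases hn1 : n i = 1
  · exact Or.inl hn1
  have hi : 2 ≤ n i := by have := (hG i).1; omega
  by_cases hp5 : 5 ≤ p
  · exact Or.inr (Or.inl (rank_eq_one_of_sigma_section hp hp5 hG hn s hs i hi))
  have hgap := h.resolve_left hp5
  have hd : p ∣ p ^ 2 := dvd_pow_self p two_ne_zero
  obtain ⟨s', hs'⟩ := exists_matrix_section_of_sigma_section hp hG hn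
    (fun _ _ => add_two_le_of_covBy hn hgap) s hs i hi hd
  -- Only p = 2 and p = 3 remain, and for these the lift modulo p² bounds the rank by 3 and 2
  -- respectively.
  have hp' : p = 2 ∨ p = 3 := by
    have h2 := hp.two_le
    have h4 : p ≠ 4 := by rintro rfl; exact absurd hp (by decide)
    omega
  clear h hgap
  rcases hp' with rfl | rfl
  · refine Or.inr (Or.inr (Or.inl ⟨rfl, ?_⟩))
    by_contra hr
    exact not_exists_section_two (by omega) hd s' hs'
  · refine Or.inr (Or.inr (Or.inr ⟨rfl, ?_⟩))
    by_contra hr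
    exact not_exists_section_three (by omega) hd s' hs'

theorem nonempty_splitting_sumExtension_iff (hp : p.Prime)
    (hG : ∀ i, IsHomocyclic p (n i) (r i) (G i)) (hn : StrictMono n)
    (h : 5 ≤ p ∨ ∀ i j, i ⋖ j → 1 < (n j : ℤ) - n i) :
    Nonempty (sumExtension hp hG hn).Splitting ↔
      ∀ i, Nonempty (homocyclicExtension hp (hG i)).Splitting := by
  simp only [sumExtension, homocyclicExtension, nonempty_splitting_kerExtension_iff]
  exact exists_sigma_section_iff hp hG hn h

theorem isSemidirectProduct_ker_sigma_iff (hp : p.Prime)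
    (hG : ∀ i, IsHomocyclic p (n i) (r i) (G i)) (hn : StrictMono n)
    (h : 5 ≤ p ∨ ∀ i j, i ⋖ j → 1 < (n j : ℤ) - n i) :
    IsSemidirectProduct (sigma hp hG hn).ker
        (∀ i, Matrix.GeneralLinearGroup (Fin (r i)) (ZMod p)) ↔
      ∀ i, IsSemidirectProduct (Op p (Aut (G i)))
        (Matrix.GeneralLinearGroup (Fin (r i)) (ZMod p)) := by
  have e : ∀ i, Nonempty (Aut (ModP p (G i)) ≃* Matrix.GeneralLinearGroup (Fin (r i)) (ZMod p)) :=
    fun i => nonempty_aut_modP_mulEquiv hp (hG i)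
  rw [isSemidirectProduct_ker_iff _ (sigma_surjective hp hG hn)
    (MulEquiv.piCongrRight fun i => (e i).some), exists_sigma_section_iff hp hG hn h]
  refine forall_congr' fun i => ?_
  rw [Op_aut_eq_ker_lam hp (hG i),
    isSemidirectProduct_ker_iff _ (lam_surjective hp (hG i)) (e i).some]

end Main

end SplitAut

theorem theorem2p1 {ι : Type*} [LinearOrder ι] (p : ℕ) (hp : p.Prime) (n r : ι → ℕ)
    (hn : StrictMono n) (G : ι → Type*) [∀ i, AddCommGroup (G i)]
    (hG : ∀ i, SplitAut.IsHomocyclic p (n i) (r i) (G i)) :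
    (5 ≤ p →
      (Nonempty (SplitAut.sumExtension hp hG hn).Splitting ↔
        ∀ i, Nonempty (SplitAut.homocyclicExtension hp (hG i)).Splitting)) ∧
    ((∀ i j, i ⋖ j → 1 < (n j : ℤ) - n i) →
      (Nonempty (SplitAut.sumExtension hp hG hn).Splitting ↔
        ∀ i, Nonempty (SplitAut.homocyclicExtension hp (hG i)).Splitting)) ∧
    (5 ≤ p →
      (SplitAut.IsSemidirectProduct (SplitAut.sigma hp hG hn).ker
          (∀ i, Matrix.GeneralLinearGroup (Fin (r i)) (ZMod p)) ↔
        ∀ i, SplitAut.IsSemidirectProduct (SplitAut.Op p (SplitAut.Aut (G i)))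
          (Matrix.GeneralLinearGroup (Fin (r i)) (ZMod p)))) ∧
    ((∀ i j, i ⋖ j → 1 < (n j : ℤ) - n i) →
      (SplitAut.IsSemidirectProduct (SplitAut.sigma hp hG hn).ker
          (∀ i, Matrix.GeneralLinearGroup (Fin (r i)) (ZMod p)) ↔
        ∀ i, SplitAut.IsSemidirectProduct (SplitAut.Op p (SplitAut.Aut (G i)))
          (Matrix.GeneralLinearGroup (Fin (r i)) (ZMod p)))) :=
  ⟨fun h => SplitAut.nonempty_splitting_sumExtension_iff hp hG hn (Or.inl h),
    fun h => SplitAut.nonempty_splitting_sumExtension_iff hp hG hn (Or.inr h),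
    fun h => SplitAut.isSemidirectProduct_ker_sigma_iff hp hG hn (Or.inl h),
    fun h => SplitAut.isSemidirectProduct_ker_sigma_iff hp hG hn (Or.inr h)⟩
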